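/- For $n\ge 3$ let $OPT_n$ be the set of triangulations of a labelled convex $n$-gon without new vertices (maximal sets of pairwise non-crossing diagonals), and let $G_n$ be its flip graph: two triangulations are joined by an edge when one arises from the other by replacing one diagonal of a quadrilateral, formed by two triangles with a common side, by the other diagonal. For a finite graph $G=(V,E)$ and $S\subset V$ let $E(S,\overline S)$ be the number of edges between $S$ and $\overline S=V\setminus S$, put $\mathrm{vol}(S)=\sum_{v\in S}\deg v$, and let $$k(G)=\min_{\emptyset\ne S\subsetneq V}\frac{E(S,\overline S)}{\min(|S|,|\overline S|)},\qquad h(G)=\min_{\emptyset\ne S\subsetneq V}\frac{E(S,\overline S)}{\min(\mathrm{vol}(S),\mathrm{vol}(\overline S))}$$ be the isoperimetric constant (unit weights) and the valence-normalized Cheeger constant. Let $$\lambda(G)=\inf\Big\{\frac{\sum_{\{v,w\}\in E}(f(v)-f(w))^2}{\sum_v \deg(v)f(v)^2}\ :\ f\neq 0,\ \sum_v\deg(v)f(v)=0\Big\}$$ be the spectral gap of the normalized graph Laplacian. For $0<\varepsilon<\frac12$ let $t_{\rm mix}(G,\varepsilon)\in\mathbb N\cup\{\infty\}$ be the least $t$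 such that the simple random walk on $G$, from every starting vertex, is after $t$ steps within total variation distance $\varepsilon$ of the stationary distribution $\pi(v)=\deg(v)/\mathrm{vol}(V)$. For odd $n$ let $thick_n\subset OPT_n$ be the set of triangulations containing a triangle whose vertices cut the sides of the $n$-gon into three arcs, each of less than $n/2$ and at least $n/10$ sides (that is, the smallest side of the central triangle has length at least $n/10$), and let $thin_n=OPT_n\setminus thick_n$. Then: 1. $|OPT_n|=\frac1{n-1}\binom{2(n-2)}{n-2}$, the $(n-2)$-nd Catalan number, for all $n\ge3$. 2. There is a constant $C$ with $k(G_n)\le C n^{-1/2}$ for all $n\ge4$. 3. There is a constant $C$ such that for all odd $n\ge11$ the sets $thick_n$ and $thin_n$ are nonempty and $E(thin_n,thick_n)/\min(|thin_n|,|thick_n|)\le C n^{-1/2}$. 4. There is a constant $C$ with $h(G_n)\le C n^{-3/2}$ for all $n\ge4$. 5. There is a constant $C$ with $\lambda(G_n)\le C n^{-3/2}$ for all $n\ge4$. 6. For every $0<\varepsilon<\frac12$ there is a constant $c>0$ with $t_{\rm mix}(G_n,\varepsilon)\ge c\,n^{3/2}$ for all $n\ge4$. -/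

import Mathlib

open scoped ENNReal

/-! Vertices of the `n`-gon are labelled `0, 1, …, n - 1` in cyclic order; a segment joining two
vertices `i < j` is written `(i, j)`. -/

namespace OuterPlanar

/-- The diagonals of the `n`-gon: segments `(i, j)` between non-consecutive vertices. -/
def diagonals (n : ℕ) : Finset (ℕ × ℕ) :=
  (Finset.range n ×ˢ Finset.range n).filter
    (fun d => d.1 + 2 ≤ d.2 ∧ ¬ (d.1 = 0 ∧ d.2 + 1 = n))

/-- Two segments cross, i.e. their endpoints strictly interleave. -/
def Crosses (d e : ℕ × ℕ) : Prop :=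
  (d.1 < e.1 ∧ e.1 < d.2 ∧ d.2 < e.2) ∨ (e.1 < d.1 ∧ d.1 < e.2 ∧ e.2 < d.2)

instance (d e : ℕ × ℕ) : Decidable (Crosses d e) := by unfold Crosses; infer_instance

/-- A triangulation of the `n`-gon without new vertices, given by its diagonals: a maximal set
of pairwise non-crossing diagonals. -/
def IsTriangulation (n : ℕ) (T : Finset (ℕ × ℕ)) : Prop :=
  T ⊆ diagonals n ∧ (∀ d ∈ T, ∀ e ∈ T, ¬ Crosses d e) ∧
    ∀ d ∈ diagonals n, d ∉ T → ∃ e ∈ T, Crosses d e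

instance (n : ℕ) (T : Finset (ℕ × ℕ)) : Decidable (IsTriangulation n T) := by
  unfold IsTriangulation; infer_instance

/-- The set of outer planar triangulations of the (labelled) `n`-gon. -/
def OPT (n : ℕ) : Type := {T : Finset (ℕ × ℕ) // IsTriangulation n T}

instance (n : ℕ) : DecidableEq (OPT n) := by unfold OPT; infer_instance

instance (n : ℕ) : Fintype (OPT n) :=
  Fintype.subtype ((diagonals n).powerset.filter (IsTriangulation n)) (fun T => by
    simp only [Finset.mem_filter, Finset.mem_powerset, and_iff_right_iff_imp]
    exact fun h => h.1)

/-- For `i < j < n`: the segment `(i, j)` is an edge of the triangulated polygon, i.e. a chosen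
diagonal or a side of the `n`-gon. -/
def IsEdge (n : ℕ) (T : Finset (ℕ × ℕ)) (i j : ℕ) : Prop :=
  (i, j) ∈ T ∨ j = i + 1 ∨ (i = 0 ∧ j + 1 = n)

instance (n : ℕ) (T : Finset (ℕ × ℕ)) (i j : ℕ) : Decidable (IsEdge n T i j) := by
  unfold IsEdge; infer_instance

/-- `T` has the two triangles `abc`, `acd` (with `a < b < c < d`) sharing the diagonal `ac`, and
`T'` arises from `T` on replacing `ac` by the other diagonal `bd` of the quadrilateral `abcd`. -/
def FlipUp (n : ℕ) (T T' : Finset (ℕ × ℕ)) : Prop :=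
  ∃ d ∈ Finset.range n, ∃ c ∈ Finset.range d, ∃ b ∈ Finset.range c, ∃ a ∈ Finset.range b,
    IsEdge n T a b ∧ IsEdge n T b c ∧ IsEdge n T c d ∧ IsEdge n T a d ∧
      (a, c) ∈ T ∧ T' = insert (b, d) (T.erase (a, c))

instance (n : ℕ) (T T' : Finset (ℕ × ℕ)) : Decidable (FlipUp n T T') := by
  unfold FlipUp; infer_instance

theorem not_flipUp_self {n : ℕ} {T : Finset (ℕ × ℕ)} (hT : IsTriangulation n T) :
    ¬ FlipUp n T T := by
  rintro ⟨d, -, c, hc, b, hb, a, ha, -, -, -, -, hac, h⟩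
  have hbd : (b, d) ∈ T := by rw [h]; exact Finset.mem_insert_self _ _
  simp only [Finset.mem_range] at hc hb ha
  exact hT.2.1 _ hac _ hbd (Or.inl ⟨ha, hb, hc⟩)

/-- The flip graph `G_n`: triangulations of the `n`-gon, joined when they differ by a diagonal
flip. A flip in a quadrilateral `abcd` replaces `ac` by `bd` or `bd` by `ac`. -/
def flipGraph (n : ℕ) : SimpleGraph (OPT n) where
  Adj T T' := FlipUp n T.1 T'.1 ∨ FlipUp n T'.1 T.1
  symm := ⟨fun _ _ h => h.symm⟩
  loopless := ⟨fun T h => h.elim (not_flipUp_self T.2) (not_flipUp_self T.2)⟩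

instance (n : ℕ) : DecidableRel (flipGraph n).Adj := fun T T' =>
  inferInstanceAs (Decidable (FlipUp n T.1 T'.1 ∨ FlipUp n T'.1 T.1))

/-- `T` has a triangle with vertices `a < b < c`, cutting the sides of the `n`-gon into arcs of
`b - a`, `c - b` and `n - (c - a)` sides, such that each arc has less than `n / 2` sides (so the
triangle is central) and at least `n / 10` sides. -/
def IsThick (n : ℕ) (T : Finset (ℕ × ℕ)) : Prop :=
  ∃ c ∈ Finset.range n, ∃ b ∈ Finset.range c, ∃ a ∈ Finset.range b,
    IsEdge n T a b ∧ IsEdge n T b c ∧ IsEdge n T a c ∧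
      ∀ m ∈ [b - a, c - b, n - (c - a)], 2 * m < n ∧ n ≤ 10 * m

instance (n : ℕ) (T : Finset (ℕ × ℕ)) : Decidable (IsThick n T) := by
  unfold IsThick; infer_instance

/-- The thick triangulations. For odd `n` there is exactly one central triangle, so the complement
consists of the triangulations whose central triangle has an arc of less than `n / 10` sides. -/
def thick (n : ℕ) : Finset (OPT n) := Finset.univ.filter (fun T => IsThick n T.1)

section Graph

variable {V : Type*} [Fintype V] [DecidableEq V] (G : SimpleGraph V) [DecidableRel G.Adj]

/-- `E(S, Sᶜ) / min(|S|, |Sᶜ|)`, with unit weights on vertices and edges. -/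
noncomputable def cutRatio (S : Finset V) : ℝ :=
  ((G.interedges S Sᶜ).card : ℝ) / min (S.card : ℝ) (Sᶜ.card : ℝ)

/-- The isoperimetric constant `k`: the minimum of `cutRatio` over the cuts into two nonempty
parts. -/
noncomputable def isoperimetricConstant : ℝ :=
  ⨅ S : {S : Finset V // S.Nonempty ∧ Sᶜ.Nonempty}, cutRatio G S.1

/-- The valence-weighted volume of a set of vertices. -/
def vol (S : Finset V) : ℕ := ∑ v ∈ S, G.degree v

/-- The valence-normalized Cheeger constant `h`: the minimum of
`E(S, Sᶜ) / min(vol S, vol Sᶜ)` over the cuts into two nonempty parts. -/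
noncomputable def cheegerConstant : ℝ :=
  ⨅ S : {S : Finset V // S.Nonempty ∧ Sᶜ.Nonempty},
    ((G.interedges S.1 S.1ᶜ).card : ℝ) / min (vol G S.1 : ℝ) (vol G S.1ᶜ : ℝ)

/-- The first nonzero eigenvalue of the normalized Laplacian, as the infimum of the Rayleigh
quotient over functions orthogonal to the constants for the valence weights. Each edge occurs
twice in the sum over ordered pairs. -/
noncomputable def spectralGap : ℝ :=
  ⨅ f : {f : V → ℝ // f ≠ 0 ∧ ∑ v, (G.degree v : ℝ) * f v = 0},
    ((1 / 2) * ∑ v, ∑ w, if G.Adj v w then (f.1 v - f.1 w) ^ 2 else 0) /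
      ∑ v, (G.degree v : ℝ) * f.1 v ^ 2

/-- Transition matrix of the simple random walk. -/
noncomputable def walkMatrix : Matrix V V ℝ :=
  Matrix.of fun v w => if G.Adj v w then (G.degree v : ℝ)⁻¹ else 0

/-- Stationary distribution of the simple random walk. -/
noncomputable def stationary (v : V) : ℝ := (G.degree v : ℝ) / (vol G Finset.univ : ℝ)

/-- Total variation distance of the walk started at `v` from stationarity after `t` steps. -/
noncomputable def tvDist (t : ℕ) (v : V) : ℝ :=
  (1 / 2) * ∑ w, |(walkMatrix G ^ t) v w - stationary G w|

/-- The `ε`-mixing time of the simple random walk: the least `t` such that from every starting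
vertex the walk is within `ε` of stationarity after `t` steps (`⊤` if there is none). -/
noncomputable def mixingTime (ε : ℝ) : ℕ∞ :=
  sInf {τ : ℕ∞ | ∃ t : ℕ, τ = (t : ℕ∞) ∧ ∀ v, tvDist G t v ≤ ε}

end Graph

end OuterPlanar

/-! One bottleneck, the cut between thick and thin triangulations, gives all the bounds. Cutting a
polygon along a chord leaves two independent smaller polygons (`card_triWith_split`). Summed over
the triangle on a fixed side, this is the Catalan recurrence; applied to a fixed triangle or
quadrilateral, it counts the triangulations containing it as a product of Catalan numbers, one for
each arc. Here `cat m` is 4^m m^(-3/2) up to constant factors (`cat_le`, `le_cat`).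

Size of the two sides: a triangulation has at most one central triangle (`Central.unique`), so
families with different central triangles are disjoint. Of order n^3 central triangles are thick and
of order n^3 are not, and each lies in at least of order 4^n n^(-9/2) triangulations. Both sides
therefore have at least of order 4^n n^(-3/2) elements (`le_card_thick`, `le_card_thin`).

Size of the cut: a flip from thick to thin destroys the thick triangle, so that triangle is half of
the flipped quadrilateral. Up to symmetry the quadrilateral has arcs x, y, z, w with x, y at least
n/10 and the thick triangle has arcs x, y, z + w. Since neither new triangle is thick, x lies in a
window of length w just below n/2, and either z is of order n or w lies in a window of length z just
below n/10 (`critical_of_thickArcs`). With n choices of the first vertex, the number of edges is at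
most of order n · 4^n n^(-3) · ∑ z^(-3/2) w^(-1/2) over the allowed pairs, and this sum is bounded
(`sum_criticalPairs_le`). So the cut has at most of order 4^n n^(-2) edges, and the ratio is of
order n^(-1/2). No parity of n is needed for this.

Every diagonal can be flipped, so all degrees are at least n - 3 (`le_degree`), and normalizing by
volume gains a factor of order 1/n. The spectral gap is at most twice the volume ratio of any cut
(`spectralGap_le`), and a walk started in one part needs time of the order of the inverse ratio to
leave it (`le_mul_volRatio`). -/

namespace OuterPlanar

/-! ### Maximal non-crossing sets of chords on a set of vertices -/

/-- The chords (sides included) of the convex polygon with vertex set `V`. -/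
def chords (V : Finset ℕ) : Finset (ℕ × ℕ) := (V ×ˢ V).filter (fun d => d.1 < d.2)

theorem mem_chords {V : Finset ℕ} {x y : ℕ} : (x, y) ∈ chords V ↔ x ∈ V ∧ y ∈ V ∧ x < y := by
  simp [chords, and_assoc]

/-- A triangulation of the polygon with vertex set `V`, given by all its edges: a maximal
non-crossing set of chords. -/
def IsTri (V : Finset ℕ) (F : Finset (ℕ × ℕ)) : Prop :=
  F ⊆ chords V ∧ (∀ d ∈ F, ∀ e ∈ F, ¬ Crosses d e) ∧
    ∀ d ∈ chords V, (∀ e ∈ F, ¬ Crosses d e) → d ∈ F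

instance (V : Finset ℕ) (F : Finset (ℕ × ℕ)) : Decidable (IsTri V F) := by
  unfold IsTri; infer_instance

/-- The triangulations of the polygon `V` that contain all the chords in `A`. -/
def triWith (V : Finset ℕ) (A : Finset (ℕ × ℕ)) : Finset (Finset (ℕ × ℕ)) :=
  (chords V).powerset.filter (fun F => IsTri V F ∧ A ⊆ F)

theorem mem_triWith {V : Finset ℕ} {A F : Finset (ℕ × ℕ)} :
    F ∈ triWith V A ↔ IsTri V F ∧ A ⊆ F := by
  simp only [triWith, Finset.mem_filter, Finset.mem_powerset, and_iff_right_iff_imp]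
  exact fun h => h.1.1

theorem crosses_iff {a b c d : ℕ} :
    Crosses (a, b) (c, d) ↔ (a < c ∧ c < b ∧ b < d) ∨ (c < a ∧ a < d ∧ d < b) := Iff.rfl

/-- The vertices on the inner side of the chord `(a, c)`. -/
def inner (V : Finset ℕ) (a c : ℕ) : Finset ℕ := V.filter (fun x => a ≤ x ∧ x ≤ c)

/-- The vertices on the outer side of the chord `(a, c)`. -/
def outer (V : Finset ℕ) (a c : ℕ) : Finset ℕ := V.filter (fun x => x ≤ a ∨ c ≤ x)

theorem mem_inner {V : Finset ℕ} {a c x : ℕ} : x ∈ inner V a c ↔ x ∈ V ∧ a ≤ x ∧ x ≤ c := by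
  simp [inner]

theorem mem_outer {V : Finset ℕ} {a c x : ℕ} : x ∈ outer V a c ↔ x ∈ V ∧ (x ≤ a ∨ c ≤ x) := by
  simp [outer]

theorem card_inner_add_card_outer {V : Finset ℕ} {a c : ℕ} (ha : a ∈ V) (hc : c ∈ V)
    (hac : a < c) : (inner V a c).card + (outer V a c).card = V.card + 2 := by
  rw [← Finset.card_union_add_card_inter]
  have h1 : inner V a c ∪ outer V a c = V := by
    ext x; simp only [Finset.mem_union, mem_inner, mem_outer]
    constructor
    · tauto
    · intro hx
      rcases le_or_gt x a with h | h
      · exact Or.inr ⟨hx, Or.inl h⟩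
      · rcases le_or_gt x c with h' | h'
        · exact Or.inl ⟨hx, h.le, h'⟩
        · exact Or.inr ⟨hx, Or.inr h'.le⟩
  have h2 : inner V a c ∩ outer V a c = {a, c} := by
    ext x
    simp only [Finset.mem_inter, mem_inner, mem_outer, Finset.mem_insert, Finset.mem_singleton]
    constructor
    · rintro ⟨⟨-, h1, h2⟩, -, h3⟩; omega
    · rintro (rfl | rfl)
      · exact ⟨⟨ha, le_rfl, hac.le⟩, ha, Or.inl le_rfl⟩
      · exact ⟨⟨hc, hac.le, le_rfl⟩, hc, Or.inr le_rfl⟩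
  rw [h1, h2, Finset.card_pair hac.ne]

theorem chords_mono {V W : Finset ℕ} (h : V ⊆ W) : chords V ⊆ chords W := by
  rintro ⟨x, y⟩ hx
  rw [mem_chords] at *
  exact ⟨h hx.1, h hx.2.1, hx.2.2⟩

theorem inner_subset (V : Finset ℕ) (a c : ℕ) : inner V a c ⊆ V := Finset.filter_subset _ _

theorem outer_subset (V : Finset ℕ) (a c : ℕ) : outer V a c ⊆ V := Finset.filter_subset _ _

theorem mem_chords_inner_or_outer {V : Finset ℕ} {a c : ℕ} {d : ℕ × ℕ} (hd : d ∈ chords V)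
    (h : ¬ Crosses d (a, c)) : d ∈ chords (inner V a c) ∨ d ∈ chords (outer V a c) := by
  obtain ⟨x, y⟩ := d
  rw [mem_chords] at *
  rw [mem_chords]
  rw [crosses_iff] at h
  simp only [mem_inner, mem_outer, hd.1, hd.2.1, true_and]
  omega

theorem not_crosses_inner_outer {V : Finset ℕ} {a c : ℕ} {d e : ℕ × ℕ}
    (hd : d ∈ chords (inner V a c)) (he : e ∈ chords (outer V a c)) :
    ¬ Crosses d e ∧ ¬ Crosses e d := by
  obtain ⟨x, y⟩ := d
  obtain ⟨z, w⟩ := e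
  rw [mem_chords] at *
  simp only [mem_inner, mem_outer] at *
  rw [crosses_iff, crosses_iff]
  omega

theorem Crosses.symm {d e : ℕ × ℕ} (h : Crosses d e) : Crosses e d := by
  unfold Crosses at *; omega

/-- `a` and `c` are the extreme vertices of the inner part, so no chord of that part crosses `(a,
c)` and maximality forces it in. -/
theorem root_mem_of_isTri_inner {V : Finset ℕ} {a c : ℕ} (ha : a ∈ V) (hc : c ∈ V) (hac : a < c)
    {F : Finset (ℕ × ℕ)} (hF : IsTri (inner V a c) F) : (a, c) ∈ F := by
  refine hF.2.2 _ ?_ ?_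
  · simp only [mem_chords, mem_inner]; simp [ha, hc, hac, hac.le]
  · rintro ⟨x, y⟩ he
    have := hF.1 he
    rw [mem_chords, mem_inner, mem_inner] at this
    rw [crosses_iff]; omega

/-- `a` and `c` are consecutive in the outer part, so no chord of that part separates them. -/
theorem side_mem_of_isTri_outer {V : Finset ℕ} {a c : ℕ} (ha : a ∈ V) (hc : c ∈ V) (hac : a < c)
    {F : Finset (ℕ × ℕ)} (hF : IsTri (outer V a c) F) : (a, c) ∈ F := by
  refine hF.2.2 _ ?_ ?_
  · simp only [mem_chords, mem_outer]; simp [ha, hc, hac]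
  · rintro ⟨x, y⟩ he
    have := hF.1 he
    rw [mem_chords, mem_outer, mem_outer] at this
    rw [crosses_iff]; omega

/-- Maximality survives restriction: the edges that are dropped lie on the outer side and cross no
chord of the inner side. -/
theorem IsTri.inter_inner {V : Finset ℕ} {a c : ℕ} {F : Finset (ℕ × ℕ)} (hF : IsTri V F)
    (h : (a, c) ∈ F) : IsTri (inner V a c) (F ∩ chords (inner V a c)) := by
  refine ⟨Finset.inter_subset_right, fun d hd e he => hF.2.1 d (Finset.mem_of_mem_inter_left hd) e
    (Finset.mem_of_mem_inter_left he), fun d hd hde => ?_⟩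
  refine Finset.mem_inter.2 ⟨hF.2.2 d (chords_mono (inner_subset V a c) hd) fun e he => ?_, hd⟩
  rcases mem_chords_inner_or_outer (hF.1 he) (hF.2.1 _ he _ h) with h' | h'
  · exact hde e (Finset.mem_inter.2 ⟨he, h'⟩)
  · exact (not_crosses_inner_outer hd h').1

theorem IsTri.inter_outer {V : Finset ℕ} {a c : ℕ} {F : Finset (ℕ × ℕ)} (hF : IsTri V F)
    (h : (a, c) ∈ F) : IsTri (outer V a c) (F ∩ chords (outer V a c)) := by
  refine ⟨Finset.inter_subset_right, fun d hd e he => hF.2.1 d (Finset.mem_of_mem_inter_left hd) e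
    (Finset.mem_of_mem_inter_left he), fun d hd hde => ?_⟩
  refine Finset.mem_inter.2 ⟨hF.2.2 d (chords_mono (outer_subset V a c) hd) fun e he => ?_, hd⟩
  rcases mem_chords_inner_or_outer (hF.1 he) (hF.2.1 _ he _ h) with h' | h'
  · exact (not_crosses_inner_outer h' hd).2
  · exact hde e (Finset.mem_inter.2 ⟨he, h'⟩)

/-- Both parts contain `(a, c)`, so a chord crossing no edge of the union stays on one side, where
maximality applies. -/
theorem IsTri.union {V : Finset ℕ} {a c : ℕ} (ha : a ∈ V) (hc : c ∈ V) (hac : a < c)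
    {F₁ F₂ : Finset (ℕ × ℕ)} (h₁ : IsTri (inner V a c) F₁) (h₂ : IsTri (outer V a c) F₂) :
    IsTri V (F₁ ∪ F₂) := by
  refine ⟨Finset.union_subset (h₁.1.trans (chords_mono (inner_subset V a c)))
    (h₂.1.trans (chords_mono (outer_subset V a c))), fun d hd e he => ?_, fun d hd hde => ?_⟩
  · rcases Finset.mem_union.1 hd with hd | hd <;> rcases Finset.mem_union.1 he with he | he
    · exact h₁.2.1 d hd e he
    · exact (not_crosses_inner_outer (h₁.1 hd) (h₂.1 he)).1
    · exact (not_crosses_inner_outer (h₁.1 he) (h₂.1 hd)).2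
    · exact h₂.2.1 d hd e he
  · rcases mem_chords_inner_or_outer hd (hde (a, c) (Finset.mem_union_left _
      (root_mem_of_isTri_inner ha hc hac h₁))) with h | h
    · exact Finset.mem_union_left _ (h₁.2.2 d h fun e he => hde e (Finset.mem_union_left _ he))
    · exact Finset.mem_union_right _ (h₂.2.2 d h fun e he => hde e (Finset.mem_union_right _ he))

theorem eq_of_mem_chords_inner_outer {V : Finset ℕ} {a c : ℕ} {d : ℕ × ℕ}
    (h₁ : d ∈ chords (inner V a c)) (h₂ : d ∈ chords (outer V a c)) : d = (a, c) := by
  obtain ⟨x, y⟩ := d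
  rw [mem_chords] at h₁ h₂
  simp only [mem_inner, mem_outer] at h₁ h₂
  rw [Prod.mk.injEq]; omega

/-- Cutting along a chord. -/
theorem card_triWith_split {V : Finset ℕ} {a c : ℕ} (ha : a ∈ V) (hc : c ∈ V) (hac : a < c)
    {A B C : Finset (ℕ × ℕ)} (hA : A ⊆ chords (inner V a c)) (hB : B ⊆ chords (outer V a c))
    (hC : C = insert (a, c) (A ∪ B)) :
    (triWith V C).card = (triWith (inner V a c) A).card * (triWith (outer V a c) B).card := by
  subst hC
  rw [← Finset.card_product]
  refine Finset.card_nbij' (fun F => (F ∩ chords (inner V a c), F ∩ chords (outer V a c)))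
    (fun p => p.1 ∪ p.2) ?_ ?_ ?_ ?_
  · intro F hF
    obtain ⟨hF, hs⟩ := mem_triWith.1 hF
    have h : (a, c) ∈ F := hs (Finset.mem_insert_self _ _)
    have hs' := (Finset.subset_insert _ _).trans hs
    exact Finset.mem_product.2
      ⟨mem_triWith.2 ⟨hF.inter_inner h,
        Finset.subset_inter (Finset.subset_union_left.trans hs') hA⟩,
      mem_triWith.2 ⟨hF.inter_outer h,
        Finset.subset_inter (Finset.subset_union_right.trans hs') hB⟩⟩
  · rintro ⟨F₁, F₂⟩ hF
    obtain ⟨h₁, h₂⟩ := Finset.mem_product.1 hF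
    obtain ⟨h₁, hA'⟩ := mem_triWith.1 h₁
    obtain ⟨h₂, hB'⟩ := mem_triWith.1 h₂
    refine mem_triWith.2 ⟨h₁.union ha hc hac h₂, Finset.insert_subset
      (Finset.mem_union_left _ (root_mem_of_isTri_inner ha hc hac h₁))
      (Finset.union_subset_union hA' hB')⟩
  · intro F hF
    obtain ⟨hF, hs⟩ := mem_triWith.1 hF
    have h : (a, c) ∈ F := hs (Finset.mem_insert_self _ _)
    ext d
    simp only [Finset.mem_union, Finset.mem_inter]
    constructor
    · tauto
    · intro hd
      rcases mem_chords_inner_or_outer (hF.1 hd) (hF.2.1 _ hd _ h) with h' | h' <;> tauto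
  · rintro ⟨F₁, F₂⟩ hF
    obtain ⟨h₁, h₂⟩ := Finset.mem_product.1 hF
    obtain ⟨h₁, -⟩ := mem_triWith.1 h₁
    obtain ⟨h₂, -⟩ := mem_triWith.1 h₂
    refine Prod.ext ?_ ?_
    · ext d
      simp only [Finset.mem_inter, Finset.mem_union]
      constructor
      · rintro ⟨h | h, h'⟩
        · exact h
        · rw [eq_of_mem_chords_inner_outer h' (h₂.1 h)]
          exact root_mem_of_isTri_inner ha hc hac h₁
      · exact fun h => ⟨Or.inl h, h₁.1 h⟩
    · ext d
      simp only [Finset.mem_inter, Finset.mem_union]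
      constructor
      · rintro ⟨h | h, h'⟩
        · rw [eq_of_mem_chords_inner_outer (h₁.1 h) h']
          exact side_mem_of_isTri_outer ha hc hac h₂
        · exact h
      · exact fun h => ⟨Or.inr h, h₂.1 h⟩

/-- Every chord with a vertex on its inner side bounds a triangle on that side. -/
theorem IsTri.exists_triangle_inner {V : Finset ℕ} {F : Finset (ℕ × ℕ)} (hF : IsTri V F) {a c : ℕ}
    (h : (a, c) ∈ F) {v : ℕ} (hv : v ∈ V) (hav : a < v) (hvc : v < c) :
    ∃ b ∈ V, a < b ∧ b < c ∧ (a, b) ∈ F ∧ (b, c) ∈ F := by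
  have hac := mem_chords.1 (hF.1 h)
  have hne : (V.filter (fun x => a < x ∧ x < c)).Nonempty :=
    ⟨v, Finset.mem_filter.2 ⟨hv, hav, hvc⟩⟩
  -- The successor of `a` in `V` is joined to `a`, so `a` has some neighbour below `c`.
  obtain ⟨s, hs, hsmin⟩ := (V.filter (fun x => a < x ∧ x < c)).exists_min_image id hne
  simp only [Finset.mem_filter, id] at hs hsmin
  have hsF : (a, s) ∈ F := by
    refine hF.2.2 _ (mem_chords.2 ⟨hac.1, hs.1, hs.2.1⟩) ?_
    rintro ⟨x, y⟩ he
    have hxy := mem_chords.1 (hF.1 he)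
    have hcr := hF.2.1 _ he _ h
    have h1 := hsmin x
    have h2 := hsmin y
    rw [crosses_iff] at *
    simp only [hxy.1, hxy.2.1, true_and] at h1 h2
    omega
  -- The apex is the largest neighbour of `a` below `c`. A chord crossing `(b, c)` would cross `(a,
  -- c)` or `(a, b)`, or else join `a` to a larger neighbour.
  obtain ⟨b, hb, hbmax⟩ := (V.filter (fun x => a < x ∧ x < c ∧ (a, x) ∈ F)).exists_max_image id
    ⟨s, Finset.mem_filter.2 ⟨hs.1, hs.2.1, hs.2.2, hsF⟩⟩
  simp only [Finset.mem_filter, id] at hb hbmax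
  refine ⟨b, hb.1, hb.2.1, hb.2.2.1, hb.2.2.2, ?_⟩
  refine hF.2.2 _ (mem_chords.2 ⟨hb.1, hac.2.1, hb.2.2.1⟩) ?_
  rintro ⟨x, y⟩ he
  have hxy := mem_chords.1 (hF.1 he)
  have hcr := hF.2.1 _ he _ h
  have hcr' := hF.2.1 _ he _ hb.2.2.2
  rw [crosses_iff] at *
  rintro (⟨h1, h2, h3⟩ | ⟨h1, h2, h3⟩)
  · omega
  · rcases eq_or_ne x a with rfl | hxa
    · exact absurd (hbmax y ⟨hxy.2.1, by omega, by omega, he⟩) (by omega)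
    · omega

/-- Every chord other than the one joining the extreme vertices bounds a triangle on its outer
side. -/
theorem IsTri.exists_triangle_outer {V : Finset ℕ} {F : Finset (ℕ × ℕ)} (hF : IsTri V F) {a c : ℕ}
    (h : (a, c) ∈ F) {i j : ℕ} (hi : i ∈ V) (hj : j ∈ V) (hiV : ∀ x ∈ V, i ≤ x ∧ x ≤ j)
    (hne : (a, c) ≠ (i, j)) :
    ∃ d ∈ V, (d < a ∧ (d, a) ∈ F ∧ (d, c) ∈ F) ∨ (c < d ∧ (a, d) ∈ F ∧ (c, d) ∈ F) := by
  have hac := mem_chords.1 (hF.1 h)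
  have hia := hiV a hac.1
  have hcj := hiV c hac.2.1
  have hroot : (i, j) ∈ F := by
    refine hF.2.2 _ (mem_chords.2 ⟨hi, hj, by omega⟩) ?_
    rintro ⟨x, y⟩ he
    have hxy := mem_chords.1 (hF.1 he)
    have := hiV x hxy.1
    have := hiV y hxy.2.1
    rw [crosses_iff]; omega
  -- Take the shortest other edge enclosing `(a, c)`. The triangle on its inner side has `(a, c)` as
  -- a side, since otherwise one of its sides would be a shorter enclosing edge.
  obtain ⟨⟨x, y⟩, hxy, hmin⟩ := (F.filter (fun e => e.1 ≤ a ∧ c ≤ e.2 ∧ e ≠ (a, c))).exists_min_image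
    (fun e => e.2 - e.1) ⟨(i, j), Finset.mem_filter.2 ⟨hroot, hia.1, hcj.2, hne.symm⟩⟩
  simp only [Finset.mem_filter, Prod.forall] at hxy hmin
  obtain ⟨hxyF, hxa, hcy, hxyne⟩ := hxy
  have hxyV := mem_chords.1 (hF.1 hxyF)
  rw [ne_eq, Prod.mk.injEq] at hxyne
  obtain ⟨b, hb, hxb, hby, h1, h2⟩ : ∃ b ∈ V, x < b ∧ b < y ∧ (x, b) ∈ F ∧ (b, y) ∈ F := by
    rcases Nat.lt_or_ge x a with hx | hx
    · exact hF.exists_triangle_inner hxyF hac.1 hx (by omega)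
    · exact hF.exists_triangle_inner hxyF hac.2.1 (by omega) (by omega)
  have c1 := hF.2.1 _ h1 _ h
  have c2 := hF.2.1 _ h2 _ h
  rw [crosses_iff] at c1 c2
  rcases Nat.lt_or_ge a b with hab | hab
  · have hcb : c ≤ b := by omega
    have : x = a ∧ b = c := by
      by_contra hcon
      have := hmin x b ⟨h1, hxa, hcb, by rwa [ne_eq, Prod.mk.injEq]⟩
      omega
    obtain ⟨rfl, rfl⟩ := this
    exact ⟨y, hxyV.2.1, Or.inr ⟨hby, hxyF, h2⟩⟩
  · have : b = a ∧ y = c := by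
      by_contra hcon
      have := hmin b y ⟨h2, hab, hcy, by rwa [ne_eq, Prod.mk.injEq]⟩
      omega
    obtain ⟨rfl, rfl⟩ := this
    exact ⟨x, hxyV.1, Or.inl ⟨hxb, h1, hxyF⟩⟩

/-! ### Counting the triangulations of a polygon -/

/-- Crossing chords have four distinct endpoints, so here the set of all chords is the only
triangulation. -/
theorem card_triWith_of_card_le_three {V : Finset ℕ} (hV : V.card ≤ 3) {A : Finset (ℕ × ℕ)}
    (hA : A ⊆ chords V) : (triWith V A).card = 1 := by
  have key : ∀ d ∈ chords V, ∀ e ∈ chords V, ¬ Crosses d e := by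
    rintro ⟨a, b⟩ hd ⟨c, d⟩ he hcr
    rw [mem_chords] at hd he
    rw [crosses_iff] at hcr
    have hsub : ({a, b, c, d} : Finset ℕ) ⊆ V := by
      intro x hx
      simp only [Finset.mem_insert, Finset.mem_singleton] at hx
      rcases hx with rfl | rfl | rfl | rfl
      exacts [hd.1, hd.2.1, he.1, he.2.1]
    have h4 : ({a, b, c, d} : Finset ℕ).card = 4 := by
      rw [Finset.card_insert_of_notMem, Finset.card_insert_of_notMem, Finset.card_pair (by omega)]
      all_goals simp only [Finset.mem_insert, Finset.mem_singleton]; omega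
    have := Finset.card_le_card hsub
    omega
  rw [Finset.card_eq_one]
  refine ⟨chords V, ?_⟩
  ext F
  rw [mem_triWith, Finset.mem_singleton]
  constructor
  · rintro ⟨hF, -⟩
    exact hF.1.antisymm fun d hd => hF.2.2 d hd fun e he => key d hd e (hF.1 he)
  · rintro rfl
    exact ⟨⟨subset_rfl, key, fun d hd _ => hd⟩, hA⟩

/-- The ranks of the elements of `V` run once through `0, …, V.card - 1`; this turns a sum over
apexes into a convolution. -/
theorem sum_card_filter_lt (V : Finset ℕ) (g : ℕ → ℕ) :
    ∑ k ∈ V, g (V.filter (· < k)).card = ∑ t ∈ Finset.range V.card, g t := by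
  induction V using Finset.induction_on_max with
  | empty => simp
  | insert m V hm ih =>
    have hmV : m ∉ V := fun h => (hm m h).false
    rw [Finset.sum_insert hmV, Finset.card_insert_of_notMem hmV, Finset.sum_range_succ, ← ih,
      add_comm]
    congr 1
    · refine Finset.sum_congr rfl fun k hk => ?_
      rw [Finset.filter_insert, if_neg (hm k hk).not_gt]
    · rw [Finset.filter_insert, if_neg (lt_irrefl m), Finset.filter_true_of_mem hm]

theorem root_mem {V : Finset ℕ} {F : Finset (ℕ × ℕ)} (hF : IsTri V F) {i j : ℕ} (hi : i ∈ V)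
    (hj : j ∈ V) (hij : i < j) (hiV : ∀ x ∈ V, i ≤ x ∧ x ≤ j) : (i, j) ∈ F := by
  refine hF.2.2 _ (mem_chords.2 ⟨hi, hj, hij⟩) ?_
  rintro ⟨x, y⟩ he
  have hxy := mem_chords.1 (hF.1 he)
  have := hiV x hxy.1
  have := hiV y hxy.2.1
  rw [crosses_iff]; omega

theorem exists_min_max {V : Finset ℕ} (hV : 2 ≤ V.card) :
    ∃ i ∈ V, ∃ j ∈ V, i < j ∧ ∀ x ∈ V, i ≤ x ∧ x ≤ j := by
  have hne : V.Nonempty := Finset.card_pos.1 (by omega)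
  refine ⟨V.min' hne, V.min'_mem hne, V.max' hne, V.max'_mem hne, ?_,
    fun x hx => ⟨V.min'_le x hx, V.le_max' x hx⟩⟩
  exact V.min'_lt_max'_of_card (by omega)

/-- The number of triangulations containing the triangle `i k j` on the root `i j`. -/
theorem card_triWith_pair {V : Finset ℕ} {i k j : ℕ} (hi : i ∈ V) (hj : j ∈ V) (hk : k ∈ V)
    (hik : i < k) (hkj : k < j) (hiV : ∀ x ∈ V, i ≤ x ∧ x ≤ j) :
    (triWith V {(i, k), (k, j)}).card =
      (triWith (inner V i k) ∅).card * (triWith (inner V k j) ∅).card := by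
  rw [card_triWith_split (a := i) (c := k) hi hk hik (A := ∅) (B := {(k, j)}) (by simp) ?_
    (by simp)]
  · congr 1
    have h1 : inner (outer V i k) k j = inner V k j := by
      ext x; simp only [mem_inner, mem_outer]; constructor
      · tauto
      · rintro ⟨h, h1, h2⟩; exact ⟨⟨h, Or.inr h1⟩, h1, h2⟩
    rw [card_triWith_split (a := k) (c := j) (by simp [mem_outer, hk])
      (by simp [mem_outer, hj, hkj.le]) hkj (A := ∅) (B := ∅) (by simp) (by simp) (by simp),
      h1, card_triWith_of_card_le_three (V := outer _ _ _) _ (by simp), mul_one]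
    have : outer (outer V i k) k j ⊆ {i, k, j} := by
      intro x
      simp only [mem_outer, Finset.mem_insert, Finset.mem_singleton]
      rintro ⟨⟨h, h1⟩, h2⟩
      have := hiV x h
      omega
    refine (Finset.card_le_card this).trans Finset.card_le_three
  · simp [mem_chords, mem_outer, hk, hj, hkj.le, hkj]

/-- The root lies in exactly one triangle, since the sides of two triangles with different apexes
would cross. The apex splits the polygon into two polygons sharing that vertex, which gives the
Catalan recurrence. -/
theorem card_triWith_empty : ∀ (m : ℕ) (V : Finset ℕ), V.card = m + 2 →
    (triWith V ∅).card = catalan m := by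
  intro m
  induction m using Nat.strong_induction_on with
  | _ m ih =>
  intro V hV
  rcases m with _ | m
  · rw [card_triWith_of_card_le_three (by omega) (by simp), catalan_zero]
  obtain ⟨i, hi, j, hj, hij, hiV⟩ := exists_min_max (V := V) (by omega)
  set U := V.filter (fun x => i < x ∧ x < j) with hU
  have hmemU : ∀ {x}, x ∈ U ↔ x ∈ V ∧ i < x ∧ x < j := by simp [hU]
  have hVU : V = insert i (insert j U) := by
    ext x
    simp only [Finset.mem_insert, hmemU]
    constructor
    · intro hx; have := hiV x hx; simp only [hx, true_and]; omega
    · rintro (rfl | rfl | h)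
      exacts [hi, hj, h.1]
  have hUcard : U.card = m + 1 := by
    have : V.card = U.card + 2 := by
      conv_lhs => rw [hVU]
      rw [Finset.card_insert_of_notMem, Finset.card_insert_of_notMem]
      · simp [hmemU]
      · simp [hmemU, hij.ne]
    omega
  have hdecomp : triWith V ∅ = U.biUnion fun k => triWith V {(i, k), (k, j)} := by
    ext F
    simp only [mem_triWith, Finset.mem_biUnion, Finset.insert_subset_iff,
      Finset.singleton_subset_iff, Finset.empty_subset, and_true]
    constructor
    · intro hF
      obtain ⟨v, hv⟩ : U.Nonempty := Finset.card_pos.1 (by omega)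
      rw [hmemU] at hv
      obtain ⟨b, hb, h1, h2, h3, h4⟩ :=
        hF.exists_triangle_inner (root_mem hF hi hj hij hiV) hv.1 hv.2.1 hv.2.2
      exact ⟨b, hmemU.2 ⟨hb, h1, h2⟩, hF, h3, h4⟩
    · rintro ⟨k, -, h, -⟩; exact h
  rw [hdecomp, Finset.card_biUnion]
  · have hterm : ∀ k ∈ U, (triWith V {(i, k), (k, j)}).card =
        catalan (U.filter (· < k)).card * catalan (m - (U.filter (· < k)).card) := by
      intro k hk
      have hk' := hmemU.1 hk
      have c1 : (inner V i k).card = (U.filter (· < k)).card + 2 := by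
        have : inner V i k = insert i (insert k (U.filter (· < k))) := by
          ext x
          simp only [mem_inner, Finset.mem_insert, Finset.mem_filter, hmemU]
          constructor
          · rintro ⟨h, h1, h2⟩; simp only [h, true_and]; omega
          · rintro (rfl | rfl | h)
            · exact ⟨hi, le_rfl, hk'.2.1.le⟩
            · exact ⟨hk'.1, hk'.2.1.le, le_rfl⟩
            · exact ⟨h.1.1, by omega, by omega⟩
        rw [this, Finset.card_insert_of_notMem, Finset.card_insert_of_notMem]
        · simp
        · simp [hmemU, hk'.2.1.ne]
      have c2 : (inner V i k).card + (inner V k j).card = V.card + 1 := by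
        have h := card_inner_add_card_outer hi hk'.1 hk'.2.1
        have : outer V i k = insert i (inner V k j) := by
          ext x
          simp only [mem_outer, mem_inner, Finset.mem_insert]
          constructor
          · rintro ⟨h, h1⟩; have := hiV x h; simp only [h, true_and]; omega
          · rintro (rfl | h)
            · exact ⟨hi, Or.inl le_rfl⟩
            · exact ⟨h.1, Or.inr h.2.1⟩
        rw [this, Finset.card_insert_of_notMem] at h
        · omega
        · simp only [mem_inner]; omega
      have c3 : (U.filter (· < k)).card < U.card :=
        Finset.card_lt_card (Finset.filter_ssubset.2 ⟨k, hk, lt_irrefl k⟩)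
      rw [card_triWith_pair hi hj hk'.1 hk'.2.1 hk'.2.2 hiV,
        ih _ (by omega) _ c1, ih (m - (U.filter (· < k)).card) (by omega) _ (by omega)]
    rw [Finset.sum_congr rfl hterm,
      sum_card_filter_lt U (fun t => catalan t * catalan (m - t)), hUcard, catalan_succ,
      Finset.sum_range]
  · intro k hk k' hk' hkk'
    rw [Finset.mem_coe, hmemU] at hk hk'
    rw [Function.onFun, Finset.disjoint_left]
    intro F hF hF'
    simp only [mem_triWith, Finset.insert_subset_iff, Finset.singleton_subset_iff] at hF hF'
    have h1 := hF.1.2.1 _ hF.2.1 _ hF'.2.2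
    have h2 := hF.1.2.1 _ hF'.2.1 _ hF.2.2
    rw [crosses_iff] at h1 h2
    omega

theorem card_triWith_empty' {V : Finset ℕ} (hV : 2 ≤ V.card) :
    (triWith V ∅).card = catalan (V.card - 2) :=
  card_triWith_empty _ _ (by omega)

/-- A triangulation of a polygon with `m + 2` vertices has `2 m + 1` edges. -/
theorem IsTri.card_eq : ∀ (m : ℕ) {V : Finset ℕ} {F : Finset (ℕ × ℕ)}, IsTri V F →
    V.card = m + 2 → F.card = 2 * m + 1 := by
  intro m
  induction m using Nat.strong_induction_on with
  | _ m ih =>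
  intro V F hF hV
  obtain ⟨i, hi, j, hj, hij, hiV⟩ := exists_min_max (V := V) (by omega)
  have hroot := root_mem hF hi hj hij hiV
  rcases m with _ | m
  · have hVe : ({i, j} : Finset ℕ) = V := Finset.eq_of_subset_of_card_le
      (by simp [Finset.insert_subset_iff, hi, hj]) (by rw [hV, Finset.card_pair hij.ne])
    have : F = {(i, j)} := by
      ext ⟨x, y⟩
      rw [Finset.mem_singleton]
      constructor
      · intro h
        have := mem_chords.1 (hF.1 h)
        rw [← hVe] at this
        simp only [Finset.mem_insert, Finset.mem_singleton] at this
        rw [Prod.mk.injEq]; omega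
      · rintro h; rwa [h]
    rw [this]; simp
  · have : ∃ v ∈ V, i < v ∧ v < j := by
      by_contra! hcon
      have : V ⊆ {i, j} := by
        intro x hx
        have := hiV x hx
        have := hcon x hx
        simp only [Finset.mem_insert, Finset.mem_singleton]; omega
      have := (Finset.card_le_card this).trans Finset.card_le_two
      omega
    obtain ⟨v, hv, hiv, hvj⟩ := this
    obtain ⟨k, hk, hik, hkj, h1, h2⟩ := hF.exists_triangle_inner hroot hv hiv hvj
    have d1 := hF.inter_inner h1
    have d2 := hF.inter_inner h2
    have hFe : F = insert (i, j) ((F ∩ chords (inner V i k)) ∪ (F ∩ chords (inner V k j))) := by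
      ext ⟨x, y⟩
      simp only [Finset.mem_insert, Finset.mem_union, Finset.mem_inter, mem_chords, mem_inner,
        Prod.mk.injEq]
      constructor
      · intro h
        have hc := mem_chords.1 (hF.1 h)
        have b1 := hiV x hc.1
        have b2 := hiV y hc.2.1
        have c1 := hF.2.1 _ h _ h1
        have c2 := hF.2.1 _ h _ h2
        rw [crosses_iff] at c1 c2
        simp only [h, hc.1, hc.2.1, true_and]
        omega
      · rintro (⟨rfl, rfl⟩ | h | h)
        exacts [hroot, h.1, h.1]
    have hsz : (inner V i k).card + (inner V k j).card = V.card + 1 := by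
      have h := card_inner_add_card_outer hi hk hik
      have : outer V i k = insert i (inner V k j) := by
        ext x
        simp only [mem_outer, mem_inner, Finset.mem_insert]
        constructor
        · rintro ⟨h, h1⟩; have := hiV x h; simp only [h, true_and]; omega
        · rintro (rfl | h)
          · exact ⟨hi, Or.inl le_rfl⟩
          · exact ⟨h.1, Or.inr h.2.1⟩
      rw [this, Finset.card_insert_of_notMem] at h
      · omega
      · simp only [mem_inner]; omega
    have two_le : ∀ {x y}, x ∈ V → y ∈ V → x < y → 2 ≤ (inner V x y).card := by
      intro x y hx hy hxy
      rw [← Finset.card_pair hxy.ne]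
      refine Finset.card_le_card ?_
      simp [Finset.insert_subset_iff, mem_inner, hx, hy, hxy.le]
    have t1 := two_le hi hk hik
    have t2 := two_le hk hj hkj
    have e1 := ih ((inner V i k).card - 2) (by omega) d1 (by omega)
    have e2 := ih ((inner V k j).card - 2) (by omega) d2 (by omega)
    rw [hFe, Finset.card_insert_of_notMem, Finset.card_union_of_disjoint]
    · omega
    · rw [Finset.disjoint_left]
      rintro ⟨x, y⟩
      simp only [Finset.mem_inter, mem_chords, mem_inner]
      omega
    · simp only [Finset.mem_union, Finset.mem_inter, mem_chords, mem_inner]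
      omega

/-! ### Triangulations of the `n`-gon and their sets of edges -/

/-- The sides of the `n`-gon. -/
def sides (n : ℕ) : Finset (ℕ × ℕ) := chords (Finset.range n) \ diagonals n

theorem mem_diagonals {n x y : ℕ} :
    (x, y) ∈ diagonals n ↔ x + 2 ≤ y ∧ y < n ∧ ¬ (x = 0 ∧ y + 1 = n) := by
  simp only [diagonals, Finset.mem_filter, Finset.mem_product, Finset.mem_range]
  omega

theorem mem_sides {n x y : ℕ} :
    (x, y) ∈ sides n ↔ x < y ∧ y < n ∧ (y = x + 1 ∨ (x = 0 ∧ y + 1 = n)) := by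
  simp only [sides, Finset.mem_sdiff, mem_chords, mem_diagonals, Finset.mem_range]
  omega

theorem diagonals_subset (n : ℕ) : diagonals n ⊆ chords (Finset.range n) := by
  rintro ⟨x, y⟩ h
  rw [mem_diagonals] at h
  simp only [mem_chords, Finset.mem_range]; omega

theorem not_crosses_side {n : ℕ} {d e : ℕ × ℕ} (hd : d ∈ chords (Finset.range n))
    (he : e ∈ sides n) : ¬ Crosses d e := by
  obtain ⟨x, y⟩ := d
  obtain ⟨z, w⟩ := e
  rw [mem_sides] at he
  simp only [mem_chords, Finset.mem_range] at hd
  rw [crosses_iff]; omega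

/-- All the edges of a triangulated `n`-gon, sides included. -/
def full (n : ℕ) (T : Finset (ℕ × ℕ)) : Finset (ℕ × ℕ) := T ∪ sides n

theorem isEdge_iff {n : ℕ} {T : Finset (ℕ × ℕ)} {i j : ℕ} (hij : i < j) (hj : j < n) :
    IsEdge n T i j ↔ (i, j) ∈ full n T := by
  simp only [IsEdge, full, Finset.mem_union, mem_sides, hij, hj, true_and]

theorem IsTriangulation.isTri_full {n : ℕ} {T : Finset (ℕ × ℕ)} (hT : IsTriangulation n T) :
    IsTri (Finset.range n) (full n T) := by
  have hTs : T ⊆ chords (Finset.range n) := hT.1.trans (diagonals_subset n)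
  refine ⟨Finset.union_subset hTs Finset.sdiff_subset, fun d hd e he => ?_, fun d hd hde => ?_⟩
  · rcases Finset.mem_union.1 he with he | he
    · rcases Finset.mem_union.1 hd with hd | hd
      · exact hT.2.1 d hd e he
      · exact fun h => not_crosses_side (hTs he) hd h.symm
    · refine not_crosses_side ?_ he
      exact Finset.union_subset hTs Finset.sdiff_subset hd
  · by_cases hdd : d ∈ diagonals n
    · by_contra hcon
      obtain ⟨e, he, hcr⟩ := hT.2.2 d hdd fun h => hcon (Finset.mem_union_left _ h)
      exact hde e (Finset.mem_union_left _ he) hcr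
    · exact Finset.mem_union_right _ (Finset.mem_sdiff.2 ⟨hd, hdd⟩)

theorem sides_subset {n : ℕ} {F : Finset (ℕ × ℕ)} (hF : IsTri (Finset.range n) F) :
    sides n ⊆ F := fun d hd => hF.2.2 d (Finset.sdiff_subset hd) fun _ he h =>
  not_crosses_side (hF.1 he) hd h.symm

theorem full_inter_diagonals {n : ℕ} {T : Finset (ℕ × ℕ)} (hT : T ⊆ diagonals n) :
    full n T ∩ diagonals n = T := by
  ext d
  simp only [full, sides, Finset.mem_inter, Finset.mem_union, Finset.mem_sdiff]
  constructor
  · tauto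
  · exact fun h => ⟨Or.inl h, hT h⟩

theorem IsTri.full_inter {n : ℕ} {F : Finset (ℕ × ℕ)} (hF : IsTri (Finset.range n) F) :
    full n (F ∩ diagonals n) = F := by
  ext d
  simp only [full, Finset.mem_inter, Finset.mem_union]
  constructor
  · rintro (h | h)
    exacts [h.1, sides_subset hF h]
  · intro h
    by_cases hd : d ∈ diagonals n
    · exact Or.inl ⟨h, hd⟩
    · exact Or.inr (Finset.mem_sdiff.2 ⟨hF.1 h, hd⟩)

theorem IsTri.isTriangulation {n : ℕ} {F : Finset (ℕ × ℕ)} (hF : IsTri (Finset.range n) F) :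
    IsTriangulation n (F ∩ diagonals n) := by
  refine ⟨Finset.inter_subset_right, fun d hd e he => hF.2.1 d (Finset.mem_of_mem_inter_left hd) e
    (Finset.mem_of_mem_inter_left he), fun d hd hdF => ?_⟩
  by_contra! hcon
  refine hdF (Finset.mem_inter.2 ⟨hF.2.2 d (diagonals_subset n hd) fun e he => ?_, hd⟩)
  by_cases hed : e ∈ diagonals n
  · exact hcon e (Finset.mem_inter.2 ⟨he, hed⟩)
  · exact not_crosses_side (diagonals_subset n hd) (Finset.mem_sdiff.2 ⟨hF.1 he, hed⟩)

/-- The triangulations of the `n`-gon that have all the edges in `A`. -/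
def optWith (n : ℕ) (A : Finset (ℕ × ℕ)) : Finset (OPT n) :=
  Finset.univ.filter (fun T => A ⊆ full n T.1)

theorem mem_optWith {n : ℕ} {A : Finset (ℕ × ℕ)} {T : OPT n} :
    T ∈ optWith n A ↔ A ⊆ full n T.1 := by simp [optWith]

/-- Adding the sides of the `n`-gon is a bijection onto full edge sets, with intersection with
`diagonals n` as inverse. -/
theorem card_optWith (n : ℕ) (A : Finset (ℕ × ℕ)) :
    (optWith n A).card = (triWith (Finset.range n) A).card := by
  refine Finset.card_bij (fun T _ => full n T.1) ?_ ?_ ?_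
  · intro T hT
    exact mem_triWith.2 ⟨T.2.isTri_full, mem_optWith.1 hT⟩
  · intro T _ T' _ h
    apply Subtype.ext
    rw [← full_inter_diagonals T.2.1, ← full_inter_diagonals T'.2.1]
    exact congrArg (· ∩ diagonals n) h
  · intro F hF
    obtain ⟨hF, hA⟩ := mem_triWith.1 hF
    exact ⟨⟨F ∩ diagonals n, hF.isTriangulation⟩,
      mem_optWith.2 (hA.trans hF.full_inter.symm.subset), hF.full_inter⟩

theorem card_OPT {n : ℕ} (hn : 3 ≤ n) : Fintype.card (OPT n) = catalan (n - 2) := by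
  have h : optWith n ∅ = Finset.univ := by ext; simp [mem_optWith]
  rw [← Finset.card_univ, ← h, card_optWith, card_triWith_empty' (by simp; omega),
    Finset.card_range]

theorem card_sides_le (n : ℕ) : (sides n).card ≤ n := by
  rcases n with _ | n
  · have : sides 0 = ∅ := by
      ext ⟨x, y⟩; simp [mem_sides]
    simp [this]
  have : sides (n + 1) ⊆ insert (0, n) ((Finset.range n).image fun i => (i, i + 1)) := by
    rintro ⟨x, y⟩ h
    rw [mem_sides] at h
    simp only [Finset.mem_insert, Finset.mem_image, Finset.mem_range, Prod.mk.injEq]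
    rcases h.2.2 with h' | h'
    · exact Or.inr ⟨x, by omega, rfl, h'.symm⟩
    · exact Or.inl (by omega)
  refine (Finset.card_le_card this).trans ((Finset.card_insert_le _ _).trans ?_)
  have := Finset.card_image_le (s := Finset.range n) (f := fun i => (i, i + 1))
  rw [Finset.card_range] at this
  omega

/-- There are `2 * (n - 2) + 1` edges in all, and at most `n` of them are sides. -/
theorem IsTriangulation.le_card {n : ℕ} (hn : 3 ≤ n) {T : Finset (ℕ × ℕ)}
    (hT : IsTriangulation n T) : n - 3 ≤ T.card := by
  have h1 := hT.isTri_full.card_eq (n - 2) (by rw [Finset.card_range]; omega)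
  have h2 := card_sides_le n
  have h3 : (full n T).card ≤ T.card + (sides n).card := Finset.card_union_le _ _
  omega

/-- The number of triangulations of a polygon with a root and `m` further sides. -/
abbrev cat (m : ℕ) : ℕ := catalan (m - 1)

theorem inner_eq_Icc {V : Finset ℕ} {a c : ℕ} (h : Finset.Icc a c ⊆ V) :
    inner V a c = Finset.Icc a c := by
  ext x
  rw [mem_inner, Finset.mem_Icc, and_iff_right_iff_imp]
  exact fun hx => h (Finset.mem_Icc.2 hx)

theorem card_triWith_inner {V : Finset ℕ} {a c : ℕ} (hac : a < c) (h : Finset.Icc a c ⊆ V) :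
    (triWith (inner V a c) ∅).card = cat (c - a) := by
  have hc : (Finset.Icc a c).card = c - a + 1 := by rw [Nat.card_Icc]; omega
  rw [inner_eq_Icc h, card_triWith_empty' (by omega), hc]; congr 1

theorem Icc_subset_range {n a c : ℕ} (hc : c < n) : Finset.Icc a c ⊆ Finset.range n := by
  intro x; simp only [Finset.mem_Icc, Finset.mem_range]; omega

theorem card_triWith_outer {n a c : ℕ} (hac : a < c) (hc : c < n) :
    (triWith (outer (Finset.range n) a c) ∅).card = cat (n - (c - a)) := by
  have h := card_inner_add_card_outer (V := Finset.range n) (a := a) (c := c)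
    (by simp; omega) (by simpa) hac
  rw [inner_eq_Icc (Icc_subset_range hc), Nat.card_Icc, Finset.card_range] at h
  rw [card_triWith_empty' (by omega)]
  congr 1; omega

/-- The number of triangulations with a given triangle. -/
theorem card_optWith_triangle {n a b c : ℕ} (hab : a < b) (hbc : b < c) (hc : c < n) :
    (optWith n {(a, c), (a, b), (b, c)}).card =
      cat (b - a) * cat (c - b) * cat (n - (c - a)) := by
  have hI := Icc_subset_range (a := a) hc
  have e1 : inner (Finset.Icc a c) a b = inner (Finset.range n) a b := by
    ext x; simp only [mem_inner, Finset.mem_Icc, Finset.mem_range]; omega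
  have e2 : inner (Finset.Icc a c) b c = inner (Finset.range n) b c := by
    ext x; simp only [mem_inner, Finset.mem_Icc, Finset.mem_range]; omega
  rw [card_optWith, card_triWith_split (a := a) (c := c) (A := {(a, b), (b, c)}) (B := ∅)
    (by simp; omega) (by simpa) (by omega) ?_ (by simp) (by simp), inner_eq_Icc hI,
    card_triWith_pair (i := a) (k := b) (j := c) (by simp; omega) (by simp; omega)
      (by simp; omega) hab hbc (by simp), e1, e2, card_triWith_outer (by omega) hc,
    card_triWith_inner hab (Icc_subset_range (by omega)),
    card_triWith_inner hbc (Icc_subset_range (by omega))]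
  rintro ⟨x, y⟩ h
  simp only [Finset.mem_insert, Finset.mem_singleton, Prod.mk.injEq] at h
  simp only [mem_chords, mem_inner, Finset.mem_range]; omega

/-- The number of triangulations with a given quadrilateral. -/
theorem card_optWith_quadrilateral {n a b c d : ℕ} (hab : a < b) (hbc : b < c) (hcd : c < d)
    (hd : d < n) :
    (optWith n {(a, d), (a, b), (b, c), (c, d)}).card =
      2 * (cat (b - a) * cat (c - b) * cat (d - c) * cat (n - (d - a))) := by
  have hI := Icc_subset_range (a := a) hd
  have hW : outer (Finset.Icc a d) a b = insert a (Finset.Icc b d) := by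
    ext x; simp only [mem_outer, Finset.mem_insert, Finset.mem_Icc]; omega
  have hW' : outer (insert a (Finset.Icc b d)) b c = insert a (insert b (Finset.Icc c d)) := by
    ext x; simp only [mem_outer, Finset.mem_insert, Finset.mem_Icc]; omega
  have hW'' : outer (insert a (insert b (Finset.Icc c d))) c d = {a, b, c, d} := by
    ext x; simp only [mem_outer, Finset.mem_insert, Finset.mem_Icc, Finset.mem_singleton]; omega
  have h4 : ({a, b, c, d} : Finset ℕ).card = 2 + 2 := by
    rw [Finset.card_insert_of_notMem, Finset.card_insert_of_notMem, Finset.card_pair (by omega)]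
    all_goals simp only [Finset.mem_insert, Finset.mem_singleton]; omega
  -- The factor 2 of the count: after the four outer polygons are cut off, only the choice of a
  -- diagonal of the quadrilateral remains.
  have s1 : (triWith {a, b, c, d} ∅).card = 2 := by rw [card_triWith_empty _ _ h4, catalan_two]
  have s2 : (triWith (insert a (insert b (Finset.Icc c d))) {(c, d)}).card = cat (d - c) * 2 := by
    rw [card_triWith_split (a := c) (c := d) (A := ∅) (B := ∅) (by simp; omega) (by simp; omega)
      hcd (by simp) (by simp) (by simp), hW'', s1, card_triWith_inner hcd]
    intro x hx; simp [hx]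
  have s3 : (triWith (insert a (Finset.Icc b d)) {(b, c), (c, d)}).card =
      cat (c - b) * (cat (d - c) * 2) := by
    rw [card_triWith_split (a := b) (c := c) (A := ∅) (B := {(c, d)}) (by simp; omega)
      (by simp; omega) hbc (by simp) ?_ (by simp), hW', s2, card_triWith_inner hbc]
    · intro x; simp only [Finset.mem_insert, Finset.mem_Icc]; omega
    · simp only [Finset.singleton_subset_iff, mem_chords, hW', Finset.mem_insert, Finset.mem_Icc]
      omega
  have s4 : (triWith (Finset.Icc a d) {(a, b), (b, c), (c, d)}).card =
      cat (b - a) * (cat (c - b) * (cat (d - c) * 2)) := by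
    rw [card_triWith_split (a := a) (c := b) (A := ∅) (B := {(b, c), (c, d)}) (by simp; omega)
      (by simp; omega) hab (by simp) ?_ (by simp), hW, s3, card_triWith_inner hab]
    · intro x; simp only [Finset.mem_Icc]; omega
    · rw [hW]
      rintro ⟨x, y⟩ h
      simp only [Finset.mem_insert, Finset.mem_singleton, Prod.mk.injEq] at h
      simp only [mem_chords, Finset.mem_insert, Finset.mem_Icc]; omega
  rw [card_optWith, card_triWith_split (a := a) (c := d) (A := {(a, b), (b, c), (c, d)}) (B := ∅)
    (by simp; omega) (by simpa) (by omega) ?_ (by simp) (by simp), inner_eq_Icc hI, s4,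
    card_triWith_outer (by omega) hd]
  · ring
  · rintro ⟨x, y⟩ h
    simp only [Finset.mem_insert, Finset.mem_singleton, Prod.mk.injEq] at h
    simp only [mem_chords, mem_inner, Finset.mem_range]; omega

/-! ### Flips -/

/-- A chord that enters a quadrilateral without crossing its sides joins two opposite vertices. -/
theorem crosses_ac {a b c d : ℕ} (hab : a < b) (hbc : b < c) (hcd : c < d) {g : ℕ × ℕ}
    (h1 : ¬ Crosses g (a, b)) (h2 : ¬ Crosses g (b, c)) (h3 : ¬ Crosses g (c, d))
    (h4 : ¬ Crosses g (a, d)) (h : Crosses g (a, c)) : g = (b, d) := by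
  obtain ⟨x, y⟩ := g
  rw [crosses_iff] at *
  rw [Prod.mk.injEq]; omega

theorem crosses_bd {a b c d : ℕ} (hab : a < b) (hbc : b < c) (hcd : c < d) {g : ℕ × ℕ}
    (h1 : ¬ Crosses g (a, b)) (h2 : ¬ Crosses g (b, c)) (h3 : ¬ Crosses g (c, d))
    (h4 : ¬ Crosses g (a, d)) (h : Crosses g (b, d)) : g = (a, c) := by
  obtain ⟨x, y⟩ := g
  rw [crosses_iff] at *
  rw [Prod.mk.injEq]; omega

theorem not_crosses_full {n : ℕ} {T : Finset (ℕ × ℕ)} {g : ℕ × ℕ} (hg : g ∈ diagonals n)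
    (h : ∀ e ∈ T, ¬ Crosses g e) : ∀ e ∈ full n T, ¬ Crosses g e := by
  intro e he
  rcases Finset.mem_union.1 he with he | he
  · exact h e he
  · exact not_crosses_side (diagonals_subset n hg) he

theorem mem_full_insert_erase {n : ℕ} {T : Finset (ℕ × ℕ)} {e f g : ℕ × ℕ} (hg : g ∈ full n T)
    (hne : g ≠ e) : g ∈ full n (insert f (T.erase e)) := by
  rcases Finset.mem_union.1 hg with h | h
  · exact Finset.mem_union_left _ (Finset.mem_insert_of_mem (Finset.mem_erase.2 ⟨hne, h⟩))
  · exact Finset.mem_union_right _ h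

/-- The edge set of the quadrilateral `abcd`. -/
def quad (a b c d : ℕ) : Finset (ℕ × ℕ) := {(a, d), (a, b), (b, c), (c, d)}

theorem quad_subset {a b c d : ℕ} {F : Finset (ℕ × ℕ)} :
    quad a b c d ⊆ F ↔ (a, d) ∈ F ∧ (a, b) ∈ F ∧ (b, c) ∈ F ∧ (c, d) ∈ F := by
  simp [quad, Finset.insert_subset_iff]

/-- Exchanging the two diagonals of a quadrilateral of a triangulation gives a triangulation. -/
theorem IsTriangulation.flip {n : ℕ} {T : Finset (ℕ × ℕ)} (hT : IsTriangulation n T)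
    {a b c d : ℕ} (hab : a < b) (hbc : b < c) (hcd : c < d) (hd : d < n)
    (hq : quad a b c d ⊆ full n T) {e f : ℕ × ℕ}
    (hef : (e = (a, c) ∧ f = (b, d)) ∨ (e = (b, d) ∧ f = (a, c))) :
    IsTriangulation n (insert f (T.erase e)) := by
  obtain ⟨had, hab', hbc', hcd'⟩ := quad_subset.1 hq
  have key : ∀ g : ℕ × ℕ, (∀ x ∈ quad a b c d, ¬ Crosses g x) →
      (Crosses g f → g = e) ∧ (Crosses g e → g = f) := by
    intro g hg
    have h4 := hg (a, d) (by simp [quad])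
    have h1 := hg (a, b) (by simp [quad])
    have h2 := hg (b, c) (by simp [quad])
    have h3 := hg (c, d) (by simp [quad])
    rcases hef with ⟨rfl, rfl⟩ | ⟨rfl, rfl⟩
    · exact ⟨crosses_bd hab hbc hcd h1 h2 h3 h4, crosses_ac hab hbc hcd h1 h2 h3 h4⟩
    · exact ⟨crosses_ac hab hbc hcd h1 h2 h3 h4, crosses_bd hab hbc hcd h1 h2 h3 h4⟩
  have hcr : Crosses e f := by
    rcases hef with ⟨rfl, rfl⟩ | ⟨rfl, rfl⟩ <;> rw [crosses_iff] <;> omega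
  have hqne : ∀ x ∈ quad a b c d, x ≠ e := by
    rintro ⟨x, y⟩ hx
    simp only [quad, Finset.mem_insert, Finset.mem_singleton, Prod.mk.injEq] at hx
    rcases hef with ⟨rfl, rfl⟩ | ⟨rfl, rfl⟩ <;> rw [ne_eq, Prod.mk.injEq] <;> omega
  have hfd : f ∈ diagonals n := by
    rcases hef with ⟨rfl, rfl⟩ | ⟨rfl, rfl⟩ <;> rw [mem_diagonals] <;> omega
  have hF := hT.isTri_full
  have hcross : ∀ g ∈ T.erase e, ¬ Crosses g f := fun g hg h =>
    (Finset.mem_erase.1 hg).1 ((key g fun x hx => hF.2.1 g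
      (Finset.mem_union_left _ (Finset.mem_of_mem_erase hg)) x (hq hx)).1 h)
  refine ⟨Finset.insert_subset hfd ((Finset.erase_subset _ _).trans hT.1), ?_, ?_⟩
  · intro g h0 g' h0'
    rcases Finset.mem_insert.1 h0 with rfl | hg <;> rcases Finset.mem_insert.1 h0' with rfl | hg'
    · unfold Crosses; omega
    · exact fun h => hcross _ hg' h.symm
    · exact hcross _ hg
    · exact hT.2.1 _ (Finset.mem_of_mem_erase hg) _ (Finset.mem_of_mem_erase hg')
  · intro g hg hgT
    by_contra! hcon
    rcases eq_or_ne g e with rfl | hge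
    · exact hcon f (Finset.mem_insert_self _ _) hcr
    have hgT' : g ∉ T := fun h => hgT (Finset.mem_insert_of_mem (Finset.mem_erase.2 ⟨hge, h⟩))
    obtain ⟨x, hx, hgx⟩ := hT.2.2 g hg hgT'
    -- If `g` was blocked in `T` only by the removed diagonal `e`, it crosses `e` but no side of the
    -- quadrilateral, hence equals the new diagonal `f`.
    rcases eq_or_ne x e with rfl | hxe
    · have := (key g fun y hy => not_crosses_full hg hcon y
        (mem_full_insert_erase (hq hy) (hqne y hy))).2 hgx
      exact hgT (this ▸ Finset.mem_insert_self _ _)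
    · exact hcon x (Finset.mem_insert_of_mem (Finset.mem_erase.2 ⟨hxe, hx⟩)) hgx

/-- Every diagonal of a triangulation can be flipped. -/
theorem exists_adj_of_mem {n : ℕ} (T : OPT n) {e : ℕ × ℕ} (he : e ∈ T.1) :
    ∃ T' : OPT n, (flipGraph n).Adj T T' ∧ e ∉ T'.1 ∧ T.1.erase e ⊆ T'.1 := by
  obtain ⟨x, y⟩ := e
  have hF := T.2.isTri_full
  have heF : (x, y) ∈ full n T.1 := Finset.mem_union_left _ he
  have hd := mem_diagonals.1 (T.2.1 he)
  obtain ⟨b, -, hxb, hby, h1, h2⟩ := hF.exists_triangle_inner heF (v := x + 1)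
    (by simp; omega) (by omega) (by omega)
  obtain ⟨d, hdn, h⟩ := hF.exists_triangle_outer heF (i := 0) (j := n - 1) (by simp; omega)
    (by simp; omega) (by simp; omega) (by rw [ne_eq, Prod.mk.injEq]; omega)
  rw [Finset.mem_range] at hdn
  -- The triangles on both sides of the diagonal form the quadrilateral. If the outer apex lies
  -- below `x`, the diagonal plays the role of `bd` and the flip is an upward one from `T'` to `T`.
  rcases h with ⟨hdx, h3, h4⟩ | ⟨hyd, h3, h4⟩
  · have hflip := T.2.flip hdx hxb hby hd.2.1 (quad_subset.2 ⟨h4, h3, h1, h2⟩)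
      (Or.inr ⟨rfl, rfl⟩)
    have hne : (d, b) ∉ T.1 := fun h' => by
      have := T.2.2.1 _ h' _ he
      rw [crosses_iff] at this; omega
    refine ⟨⟨_, hflip⟩, Or.inr ?_, ?_, Finset.subset_insert _ _⟩
    · refine ⟨y, by simp; omega, b, by simp; omega, x, by simp; omega, d, by simp; omega, ?_⟩
      rw [isEdge_iff hdx (by omega), isEdge_iff hxb (by omega), isEdge_iff hby (by omega),
        isEdge_iff (by omega) (by omega)]
      refine ⟨mem_full_insert_erase h3 ?_, mem_full_insert_erase h1 ?_,
        mem_full_insert_erase h2 ?_, mem_full_insert_erase h4 ?_, Finset.mem_insert_self _ _, ?_⟩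
      iterate 4 rw [ne_eq, Prod.mk.injEq]; omega
      rw [Finset.erase_insert (fun h' => hne (Finset.mem_of_mem_erase h')), Finset.insert_erase he]
    · change (x, y) ∉ insert (d, b) (T.1.erase (x, y))
      simp only [Finset.mem_insert, Finset.mem_erase, Prod.mk.injEq, ne_eq, not_true_eq_false,
        false_and, or_false]
      omega
  · have hflip := T.2.flip hxb hby hyd hdn (quad_subset.2 ⟨h3, h1, h2, h4⟩)
      (Or.inl ⟨rfl, rfl⟩)
    refine ⟨⟨_, hflip⟩, Or.inl ?_, ?_, Finset.subset_insert _ _⟩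
    · refine ⟨d, by simp; omega, y, by simp; omega, b, by simp; omega, x, by simp; omega, ?_⟩
      rw [isEdge_iff hxb (by omega), isEdge_iff hby (by omega), isEdge_iff hyd (by omega),
        isEdge_iff (by omega) (by omega)]
      exact ⟨h1, h2, h4, h3, he, rfl⟩
    · change (x, y) ∉ insert (b, d) (T.1.erase (x, y))
      simp only [Finset.mem_insert, Finset.mem_erase, Prod.mk.injEq, ne_eq, not_true_eq_false,
        false_and, or_false]
      omega

/-- Each flip loses its own diagonal and keeps all the others, so different diagonals lead to
different neighbours. A lower bound suffices, since volumes occur in denominators. -/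
theorem le_degree {n : ℕ} (hn : 3 ≤ n) (T : OPT n) : n - 3 ≤ (flipGraph n).degree T := by
  refine (T.2.le_card hn).trans ?_
  choose f hf using fun e : {e // e ∈ T.1} => exists_adj_of_mem T e.2
  rw [← Finset.card_attach, ← SimpleGraph.card_neighborFinset_eq_degree]
  refine Finset.card_le_card_of_injOn f (fun e _ => by
    rw [Finset.mem_coe, SimpleGraph.mem_neighborFinset]; exact (hf e).1) ?_
  intro e _ e' _ h
  by_contra hne
  refine (hf e).2.1 (h ▸ (hf e').2.2 (Finset.mem_erase.2 ⟨fun h' => hne (Subtype.ext h'), e.2⟩))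

/-! ### Central triangles -/

theorem chord_beside_triangle {a b c x y : ℕ} (hxy : x < y) (h1 : ¬ Crosses (x, y) (a, b))
    (h2 : ¬ Crosses (x, y) (b, c)) (h3 : ¬ Crosses (x, y) (a, c)) (hab : a < b) :
    (a ≤ x ∧ y ≤ b) ∨ (b ≤ x ∧ y ≤ c) ∨ ((x ≤ a ∨ c ≤ x) ∧ (y ≤ a ∨ c ≤ y)) := by
  rw [crosses_iff] at *; omega

/-- The edge set of the triangle `abc`. -/
def tri (a b c : ℕ) : Finset (ℕ × ℕ) := {(a, c), (a, b), (b, c)}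

theorem tri_subset {a b c : ℕ} {F : Finset (ℕ × ℕ)} :
    tri a b c ⊆ F ↔ (a, c) ∈ F ∧ (a, b) ∈ F ∧ (b, c) ∈ F := by
  simp [tri, Finset.insert_subset_iff]

/-- The triangle `abc` is central: each of its arcs has less than half of the sides. -/
def Central (n a b c : ℕ) : Prop :=
  a < b ∧ b < c ∧ c < n ∧ 2 * (b - a) < n ∧ 2 * (c - b) < n ∧ 2 * (n - (c - a)) < n

/-- A different triangle that crosses nothing has all its vertices in one closed arc of the first.
That arc has less than `n / 2` sides, so the second triangle has an arc of more than `n / 2` sides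
around the rest. -/
theorem Central.unique {n : ℕ} {F : Finset (ℕ × ℕ)} (hF : ∀ d ∈ F, ∀ e ∈ F, ¬ Crosses d e)
    {a b c a' b' c' : ℕ} (h : Central n a b c) (h' : Central n a' b' c')
    (ht : tri a b c ⊆ F) (ht' : tri a' b' c' ⊆ F) : a = a' ∧ b = b' ∧ c = c' := by
  rw [tri_subset] at ht ht'
  obtain ⟨h1, h2, h3⟩ := ht
  obtain ⟨h1', h2', h3'⟩ := ht'
  obtain ⟨k1, k2, k3, k4, k5, k6⟩ := h
  obtain ⟨k1', k2', k3', k4', k5', k6'⟩ := h'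
  have e1 := chord_beside_triangle k1' (hF _ h2' _ h2) (hF _ h2' _ h3) (hF _ h2' _ h1) k1
  have e2 := chord_beside_triangle k2' (hF _ h3' _ h2) (hF _ h3' _ h3) (hF _ h3' _ h1) k1
  have e3 := chord_beside_triangle (k1'.trans k2') (hF _ h1' _ h2) (hF _ h1' _ h3)
    (hF _ h1' _ h1) k1
  clear hF h1 h2 h3 h1' h2' h3'
  rcases e1 with e1 | e1 | e1 <;> rcases e2 with e2 | e2 | e2 <;>
    rcases e3 with e3 | e3 | e3 <;> omega

/-- The three arcs of a triangle are all less than `n / 2` and at least `n / 10`. -/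
def ThickArcs (n p q r : ℕ) : Prop :=
  (2 * p < n ∧ n ≤ 10 * p) ∧ (2 * q < n ∧ n ≤ 10 * q) ∧ (2 * r < n ∧ n ≤ 10 * r)

theorem isThick_iff {n : ℕ} {T : Finset (ℕ × ℕ)} : IsThick n T ↔ ∃ a b c, a < b ∧ b < c ∧ c < n ∧
    tri a b c ⊆ full n T ∧ ThickArcs n (b - a) (c - b) (n - (c - a)) := by
  simp only [IsThick, tri_subset, Finset.mem_range, ThickArcs, List.forall_mem_cons,
    List.not_mem_nil, false_imp_iff, implies_true, and_true]
  constructor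
  · rintro ⟨c, hc, b, hb, a, ha, h1, h2, h3, h4⟩
    rw [isEdge_iff (by omega) (by omega)] at h1 h2 h3
    exact ⟨a, b, c, ha, hb, hc, ⟨h3, h1, h2⟩, h4⟩
  · rintro ⟨a, b, c, ha, hb, hc, ⟨h3, h1, h2⟩, h4⟩
    rw [← isEdge_iff (by omega) (by omega)] at h1 h2 h3
    exact ⟨c, hc, b, hb, a, ha, h1, h2, h3, h4⟩

theorem mem_thick {n : ℕ} {T : OPT n} : T ∈ thick n ↔ IsThick n T.1 := by simp [thick]

theorem optWith_subset_thick {n a b c : ℕ} (hab : a < b) (hbc : b < c) (hc : c < n)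
    (h : ThickArcs n (b - a) (c - b) (n - (c - a))) : optWith n (tri a b c) ⊆ thick n :=
  fun _ hT => mem_thick.2 (isThick_iff.2 ⟨a, b, c, hab, hbc, hc, mem_optWith.1 hT, h⟩)

/-- A thick triangle is central, so by uniqueness a central triangle that is not thick excludes one.
-/
theorem optWith_subset_thin {n a b c : ℕ} (h : Central n a b c)
    (h' : ¬ ThickArcs n (b - a) (c - b) (n - (c - a))) : optWith n (tri a b c) ⊆ (thick n)ᶜ := by
  intro T hT
  rw [Finset.mem_compl, mem_thick, isThick_iff]
  rintro ⟨x, y, z, hxy, hyz, hz, ht, harc⟩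
  have hc : Central n x y z := ⟨hxy, hyz, hz, harc.1.1, harc.2.1.1, harc.2.2.1⟩
  obtain ⟨rfl, rfl, rfl⟩ := h.unique T.2.isTri_full.2.1 hc (mem_optWith.1 hT) ht
  exact h' harc

/-- By uniqueness of the central triangle the families counted here are disjoint. -/
theorem sum_le_card {n : ℕ} (S : Finset (OPT n)) (Λ : Finset (ℕ × ℕ × ℕ))
    (hΛ : ∀ t ∈ Λ, Central n t.1 t.2.1 t.2.2)
    (hS : ∀ t ∈ Λ, optWith n (tri t.1 t.2.1 t.2.2) ⊆ S) :
    ∑ t ∈ Λ, cat (t.2.1 - t.1) * cat (t.2.2 - t.2.1) * cat (n - (t.2.2 - t.1)) ≤ S.card := by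
  calc _ = ∑ t ∈ Λ, (optWith n (tri t.1 t.2.1 t.2.2)).card := by
        refine Finset.sum_congr rfl fun t ht => ?_
        obtain ⟨h1, h2, h3, -⟩ := hΛ t ht
        exact (card_optWith_triangle h1 h2 h3).symm
    _ = (Λ.biUnion fun t => optWith n (tri t.1 t.2.1 t.2.2)).card := by
        refine (Finset.card_biUnion fun t ht t' ht' hne => ?_).symm
        rw [Function.onFun, Finset.disjoint_left]
        intro T hT hT'
        obtain ⟨h1, h2, h3⟩ := (hΛ t ht).unique T.2.isTri_full.2.1 (hΛ t' ht')
          (mem_optWith.1 hT) (mem_optWith.1 hT')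
        exact hne (Prod.ext h1 (Prod.ext h2 h3))
    _ ≤ _ := Finset.card_le_card (Finset.biUnion_subset.2 hS)

theorem cat_pos (m : ℕ) : 0 < cat m := by
  rw [cat, Nat.pos_iff_ne_zero, ← Nat.pos_iff_ne_zero, catalan_eq_centralBinom_div]
  exact Nat.div_pos (Nat.le_of_dvd (Nat.centralBinom_pos _) (Nat.succ_dvd_centralBinom _))
    (Nat.succ_pos _)

theorem nonempty_optWith {n a b c : ℕ} (hab : a < b) (hbc : b < c) (hc : c < n) :
    (optWith n (tri a b c)).Nonempty := by
  rw [← Finset.card_pos, tri, card_optWith_triangle hab hbc hc]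
  exact Nat.mul_pos (Nat.mul_pos (cat_pos _) (cat_pos _)) (cat_pos _)

theorem thick_nonempty {n : ℕ} (hn : 11 ≤ n) : (thick n).Nonempty := by
  -- Two arcs equal `n / 3` rounded up and the third is what remains.
  refine (nonempty_optWith (n := n) (a := 0) (b := (n + 2) / 3) (c := 2 * ((n + 2) / 3))
    (by omega) (by omega) (by omega)).mono (optWith_subset_thick (by omega) (by omega) (by omega) ?_)
  unfold ThickArcs; omega

theorem thin_nonempty {n : ℕ} (hn : 11 ≤ n) (hodd : Odd n) : ((thick n)ᶜ).Nonempty := by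
  obtain ⟨k, rfl⟩ := hodd
  -- The arcs are `1, k, k`: central because `n` is odd, and not thick because `n` exceeds 10.
  refine (nonempty_optWith (n := 2 * k + 1) (a := 0) (b := 1) (c := k + 1)
    (by omega) (by omega) (by omega)).mono (optWith_subset_thin ?_ ?_)
  · unfold Central; omega
  · unfold ThickArcs; omega

/-! ### The edges between thick and thin triangulations -/

/-- `T'` arises from `T` by a flip in the quadrilateral `abcd`. -/
def FlipAt (n a b c d : ℕ) (T T' : Finset (ℕ × ℕ)) : Prop :=
  quad a b c d ⊆ full n T ∧ (((a, c) ∈ T ∧ T' = insert (b, d) (T.erase (a, c))) ∨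
    ((b, d) ∈ T ∧ T' = insert (a, c) (T.erase (b, d))))

theorem exists_flipAt {n : ℕ} {T T' : OPT n} (h : (flipGraph n).Adj T T') :
    ∃ a b c d, a < b ∧ b < c ∧ c < d ∧ d < n ∧ FlipAt n a b c d T.1 T'.1 := by
  rcases h with ⟨d, hd, c, hc, b, hb, a, ha, h1, h2, h3, h4, hac, h⟩ |
    ⟨d, hd, c, hc, b, hb, a, ha, h1, h2, h3, h4, hac, h⟩
  all_goals
    rw [Finset.mem_range] at hd hc hb ha
    rw [isEdge_iff (by omega) (by omega)] at h1 h2 h3 h4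
    refine ⟨a, b, c, d, ha, hb, hc, hd, ?_⟩
  · exact ⟨quad_subset.2 ⟨h4, h1, h2, h3⟩, Or.inl ⟨hac, h⟩⟩
  · have hbd : (b, d) ∉ T'.1 := fun h' => by
      have := T'.2.2.1 _ h' _ hac
      rw [crosses_iff] at this; omega
    refine ⟨?_, Or.inr ⟨by rw [h]; exact Finset.mem_insert_self _ _, ?_⟩⟩
    · rw [h, quad_subset]
      refine ⟨mem_full_insert_erase h4 ?_, mem_full_insert_erase h1 ?_,
        mem_full_insert_erase h2 ?_, mem_full_insert_erase h3 ?_⟩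
      iterate 4 rw [ne_eq, Prod.mk.injEq]; omega
    · rw [h, Finset.erase_insert fun h' => hbd (Finset.mem_of_mem_erase h'),
        Finset.insert_erase hac]

/-- The diagonals `ac` and `bd` cross, so `T` contains only one of them and the quadrilateral
determines the flip. -/
theorem FlipAt.right_unique {n a b c d : ℕ} (hab : a < b) (hbc : b < c) (hcd : c < d)
    {T T₁ T₂ : Finset (ℕ × ℕ)} (hT : IsTriangulation n T) (h₁ : FlipAt n a b c d T T₁)
    (h₂ : FlipAt n a b c d T T₂) : T₁ = T₂ := by
  have : ¬ ((a, c) ∈ T ∧ (b, d) ∈ T) := fun h => by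
    have := hT.2.1 _ h.1 _ h.2
    rw [crosses_iff] at this; omega
  rcases h₁.2 with h₁ | h₁ <;> rcases h₂.2 with h₂ | h₂
  · rw [h₁.2, h₂.2]
  · exact absurd ⟨h₁.1, h₂.1⟩ this
  · exact absurd ⟨h₂.1, h₁.1⟩ this
  · rw [h₁.2, h₂.2]

/-- The condition on the arcs `x, y, z, w` of a quadrilateral that is satisfied when a flip turns
the thick triangle with arcs `x, y, z + w` into a thin one, up to a symmetry. -/
def Critical (n : ℕ) (t : ℕ × ℕ × ℕ × ℕ) : Prop :=
  n ≤ 10 * t.1 ∧ n ≤ 10 * t.2.1 ∧ 2 * t.1 < n ∧ n ≤ 2 * (t.2.2.2 + t.1) ∧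
    (n ≤ 20 * t.2.2.1 ∨ (10 * t.2.2.2 < n ∧ n ≤ 10 * (t.2.2.1 + t.2.2.2)))

instance (n : ℕ) (t : ℕ × ℕ × ℕ × ℕ) : Decidable (Critical n t) := by
  unfold Critical; infer_instance

/-- Rotation of the arcs of a quadrilateral. -/
def rot (t : ℕ × ℕ × ℕ × ℕ) : ℕ × ℕ × ℕ × ℕ := (t.2.1, t.2.2.1, t.2.2.2, t.1)

/-- Reflection of the arcs of a quadrilateral. -/
def refl (t : ℕ × ℕ × ℕ × ℕ) : ℕ × ℕ × ℕ × ℕ := (t.2.1, t.1, t.2.2.2, t.2.2.1)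

/-- The new triangles have arcs `y, z, w + x` and `w, x, y + z`. Each fails to be thick either
because its short arc `z` or `w` is below `n / 10`, or because its long arc is at least `n / 2`. The
long arcs add up to `n`, so after a suitable reflection `w + x` is at least `n / 2`, which puts `x`
in a window of length `w`. If moreover `z` is below `n / 20`, then `z + w ≥ n / 10` and the other
failure confine `w` to a window of length `z`. -/
theorem critical_of_thickArcs {n x y z w : ℕ} (hs : x + y + z + w = n)
    (h : ThickArcs n x y (z + w)) (h1 : ¬ ThickArcs n y z (w + x))
    (h2 : ¬ ThickArcs n w x (y + z)) : Critical n (x, y, z, w) ∨ Critical n (refl (x, y, z, w)) := by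
  unfold ThickArcs at *
  simp only [Critical, refl]
  have h1' : 10 * z < n ∨ n ≤ 2 * (w + x) := by omega
  have h2' : 10 * w < n ∨ n ≤ 2 * (y + z) := by omega
  clear h1 h2
  omega

theorem thickArcs_rotate {n x y z : ℕ} (h : ThickArcs n x y z) : ThickArcs n y z x :=
  ⟨h.2.1, h.2.2, h.1⟩

/-- Some symmetry of the quadrilateral makes its arcs critical. -/
def CriticalUpToSymm (n : ℕ) (t : ℕ × ℕ × ℕ × ℕ) : Prop :=
  ∃ i ∈ Finset.range 4, Critical n (rot^[i] t) ∨ Critical n (refl (rot^[i] t))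

instance (n : ℕ) (t : ℕ × ℕ × ℕ × ℕ) : Decidable (CriticalUpToSymm n t) := by
  unfold CriticalUpToSymm; infer_instance

theorem not_thickArcs {n : ℕ} {T : Finset (ℕ × ℕ)} (h : ¬ IsThick n T) {a b c : ℕ} (hab : a < b)
    (hbc : b < c) (hc : c < n) (ht : tri a b c ⊆ full n T) :
    ¬ ThickArcs n (b - a) (c - b) (n - (c - a)) := fun h' =>
  h (isThick_iff.2 ⟨a, b, c, hab, hbc, hc, ht, h'⟩)

/-- Two triangles on the same side of a common edge have crossing sides unless their apexes agree.
The next two lemmas treat the other positions of the apex. -/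
theorem apex_unique {F : Finset (ℕ × ℕ)} (hF : ∀ d ∈ F, ∀ e ∈ F, ¬ Crosses d e)
    {a b c x : ℕ} (hax : a < x) (hxc : x < c) (hab : a < b) (hbc : b < c)
    (h1 : (a, x) ∈ F) (h2 : (x, c) ∈ F) (h3 : (a, b) ∈ F) (h4 : (b, c) ∈ F) : x = b := by
  have k1 := hF _ h1 _ h4
  have k2 := hF _ h2 _ h3
  rw [crosses_iff] at k1 k2; omega

theorem upper_apex_unique {F : Finset (ℕ × ℕ)} (hF : ∀ d ∈ F, ∀ e ∈ F, ¬ Crosses d e)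
    {a b c x : ℕ} (hab : a < b) (hbx : b < x) (hbc : b < c) (h1 : (a, x) ∈ F)
    (h2 : (b, x) ∈ F) (h3 : (a, c) ∈ F) (h4 : (b, c) ∈ F) : x = c := by
  have k1 := hF _ h1 _ h4
  have k2 := hF _ h2 _ h3
  rw [crosses_iff] at k1 k2; omega

theorem lower_apex_unique {F : Finset (ℕ × ℕ)} (hF : ∀ d ∈ F, ∀ e ∈ F, ¬ Crosses d e)
    {a b c x : ℕ} (hxb : x < b) (hab : a < b) (hbc : b < c) (h1 : (x, b) ∈ F)
    (h2 : (x, c) ∈ F) (h3 : (a, b) ∈ F) (h4 : (a, c) ∈ F) : x = a := by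
  have k1 := hF _ h1 _ h4
  have k2 := hF _ h2 _ h3
  rw [crosses_iff] at k1 k2; omega

/-- The thick triangle does not survive, so the flipped diagonal is one of its sides, and uniqueness
of apexes makes it one of the two halves of the quadrilateral. The two choices of diagonal and two
choices of half are the four rotations. -/
theorem FlipAt.critical {n a b c d : ℕ} (hab : a < b) (hbc : b < c) (hcd : c < d) (hd : d < n)
    {T T' : Finset (ℕ × ℕ)} (hT : IsTriangulation n T) (h : FlipAt n a b c d T T')
    (hthick : IsThick n T) (hthin : ¬ IsThick n T') :
    CriticalUpToSymm n (b - a, c - b, d - c, n - (d - a)) := by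
  have hF := hT.isTri_full.2.1
  obtain ⟨had, hab', hbc', hcd'⟩ := quad_subset.1 h.1
  obtain ⟨u, v, w, huv, hvw, hw, ht, harc⟩ := isThick_iff.1 hthick
  obtain ⟨huw', huv', hvw'⟩ := tri_subset.1 ht
  have hnot : ¬ tri u v w ⊆ full n T' := fun h' => not_thickArcs hthin huv hvw hw h' harc
  rcases h.2 with ⟨he, rfl⟩ | ⟨he, rfl⟩
  · have hbd : (b, d) ∈ full n (insert (b, d) (T.erase (a, c))) :=
      Finset.mem_union_left _ (Finset.mem_insert_self _ _)
    have m1 := mem_full_insert_erase (f := (b, d)) had (e := (a, c))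
      (by rw [ne_eq, Prod.mk.injEq]; omega)
    have m2 := mem_full_insert_erase (f := (b, d)) hab' (e := (a, c))
      (by rw [ne_eq, Prod.mk.injEq]; omega)
    have m3 := mem_full_insert_erase (f := (b, d)) hbc' (e := (a, c))
      (by rw [ne_eq, Prod.mk.injEq]; omega)
    have m4 := mem_full_insert_erase (f := (b, d)) hcd' (e := (a, c))
      (by rw [ne_eq, Prod.mk.injEq]; omega)
    have n1 := not_thickArcs hthin hab (hbc.trans hcd) hd (tri_subset.2 ⟨m1, m2, hbd⟩)
    have n2 := not_thickArcs hthin hbc hcd hd (tri_subset.2 ⟨hbd, m3, m4⟩)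
    have hcase : (u = a ∧ v = b ∧ w = c) ∨ (u = a ∧ v = c ∧ w = d) := by
      have : (u = a ∧ w = c) ∨ (u = a ∧ v = c) ∨ (v = a ∧ w = c) := by
        by_contra hcon
        refine hnot (tri_subset.2 ⟨mem_full_insert_erase huw' ?_, mem_full_insert_erase huv' ?_,
          mem_full_insert_erase hvw' ?_⟩)
        all_goals rw [ne_eq, Prod.mk.injEq]; omega
      rcases this with ⟨rfl, rfl⟩ | ⟨rfl, rfl⟩ | ⟨rfl, rfl⟩
      · exact Or.inl ⟨rfl, apex_unique hF huv hvw hab hbc huv' hvw' hab' hbc', rfl⟩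
      · exact Or.inr ⟨rfl, rfl, upper_apex_unique hF huv hvw hcd huw' hvw' had hcd'⟩
      · exact absurd (crosses_iff.2 (Or.inl ⟨huv, hvw, hcd⟩)) (hF _ huw' _ had)
    rcases hcase with ⟨rfl, rfl, rfl⟩ | ⟨rfl, rfl, rfl⟩
    · refine ⟨0, by simp, critical_of_thickArcs (by omega) ?_ ?_ ?_⟩
      · convert harc using 1; omega
      · convert n2 using 2; omega
      · intro h'; apply n1; convert thickArcs_rotate h' using 1; omega
    · refine ⟨2, by simp, critical_of_thickArcs (x := w - v) (y := n - (w - u)) (z := b - u)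
        (w := v - b) (by omega) ?_ ?_ ?_⟩
      · convert thickArcs_rotate harc using 1; omega
      · intro h'; apply n1
        convert thickArcs_rotate h' using 1; omega
      · convert n2 using 2; omega
  · have hac : (a, c) ∈ full n (insert (a, c) (T.erase (b, d))) :=
      Finset.mem_union_left _ (Finset.mem_insert_self _ _)
    have m1 := mem_full_insert_erase (f := (a, c)) had (e := (b, d))
      (by rw [ne_eq, Prod.mk.injEq]; omega)
    have m2 := mem_full_insert_erase (f := (a, c)) hab' (e := (b, d))
      (by rw [ne_eq, Prod.mk.injEq]; omega)
    have m3 := mem_full_insert_erase (f := (a, c)) hbc' (e := (b, d))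
      (by rw [ne_eq, Prod.mk.injEq]; omega)
    have m4 := mem_full_insert_erase (f := (a, c)) hcd' (e := (b, d))
      (by rw [ne_eq, Prod.mk.injEq]; omega)
    have n1 := not_thickArcs hthin hab hbc (hcd.trans hd) (tri_subset.2 ⟨hac, m2, m3⟩)
    have n2 := not_thickArcs hthin (hab.trans hbc) hcd hd (tri_subset.2 ⟨m1, hac, m4⟩)
    have hcase : (u = b ∧ v = c ∧ w = d) ∨ (u = a ∧ v = b ∧ w = d) := by
      have : (u = b ∧ w = d) ∨ (u = b ∧ v = d) ∨ (v = b ∧ w = d) := by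
        by_contra hcon
        refine hnot (tri_subset.2 ⟨mem_full_insert_erase huw' ?_, mem_full_insert_erase huv' ?_,
          mem_full_insert_erase hvw' ?_⟩)
        all_goals rw [ne_eq, Prod.mk.injEq]; omega
      rcases this with ⟨rfl, rfl⟩ | ⟨rfl, rfl⟩ | ⟨rfl, rfl⟩
      · exact Or.inl ⟨rfl, apex_unique hF huv hvw hbc hcd huv' hvw' hbc' hcd', rfl⟩
      · exact absurd (crosses_iff.2 (Or.inl ⟨hab, huv, hvw⟩)) (hF _ had _ huw')
      · exact Or.inr ⟨lower_apex_unique hF huv hab hvw huv' huw' hab' had, rfl, rfl⟩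
    rcases hcase with ⟨rfl, rfl, rfl⟩ | ⟨rfl, rfl, rfl⟩
    · refine ⟨1, by simp, critical_of_thickArcs (x := v - u) (y := w - v) (z := n - (w - a))
        (w := u - a) (by omega) ?_ ?_ ?_⟩
      · convert harc using 1; omega
      · intro h'; apply n2
        convert thickArcs_rotate (thickArcs_rotate h') using 1; omega
      · convert n1 using 2; omega
    · refine ⟨3, by simp, critical_of_thickArcs (x := n - (w - u)) (y := v - u) (z := c - v)
        (w := w - c) (by omega) ?_ ?_ ?_⟩
      · convert thickArcs_rotate (thickArcs_rotate harc) using 1; omega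
      · convert n1 using 2; omega
      · intro h'; apply n2
        convert thickArcs_rotate (thickArcs_rotate h') using 1; omega

/-- The number of triangulations of the four polygons cut off by a quadrilateral. -/
def weight (t : ℕ × ℕ × ℕ × ℕ) : ℕ := cat t.1 * cat t.2.1 * cat t.2.2.1 * cat t.2.2.2

/-- The compositions of `n` into four positive parts. -/
def comps (n : ℕ) : Finset (ℕ × ℕ × ℕ × ℕ) :=
  (Finset.range n ×ˢ Finset.range n ×ˢ Finset.range n ×ˢ Finset.range n).filter
    (fun t => 0 < t.1 ∧ 0 < t.2.1 ∧ 0 < t.2.2.1 ∧ 0 < t.2.2.2 ∧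
      t.1 + t.2.1 + t.2.2.1 + t.2.2.2 = n)

theorem mem_comps {n x y z w : ℕ} : (x, y, z, w) ∈ comps n ↔
    0 < x ∧ 0 < y ∧ 0 < z ∧ 0 < w ∧ x + y + z + w = n := by
  simp only [comps, Finset.mem_filter, Finset.mem_product, Finset.mem_range]; omega

/-- A weight-preserving injection of the compositions can be undone in the condition; this is
applied to rotations and to the reflection. -/
theorem sum_filter_comp_le {n : ℕ} {σ : ℕ × ℕ × ℕ × ℕ → ℕ × ℕ × ℕ × ℕ}
    (hσ : Function.Injective σ) (hmaps : ∀ t ∈ comps n, σ t ∈ comps n)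
    (hw : ∀ t, weight (σ t) = weight t) (P : ℕ × ℕ × ℕ × ℕ → Prop) [DecidablePred P] :
    ∑ t ∈ (comps n).filter (fun t => P (σ t)), weight t ≤
      ∑ t ∈ (comps n).filter P, weight t := by
  calc _ = ∑ t ∈ ((comps n).filter fun t => P (σ t)).image σ, weight t := by
        rw [Finset.sum_image fun _ _ _ _ h => hσ h]
        exact Finset.sum_congr rfl fun t _ => (hw t).symm
    _ ≤ _ := by
        refine Finset.sum_le_sum_of_subset ?_
        intro t ht
        obtain ⟨s, hs, rfl⟩ := Finset.mem_image.1 ht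
        obtain ⟨hs, hP⟩ := Finset.mem_filter.1 hs
        exact Finset.mem_filter.2 ⟨hmaps s hs, hP⟩

theorem rot_injective : Function.Injective rot := by
  rintro ⟨a, b, c, d⟩ ⟨a', b', c', d'⟩ h
  simp only [rot, Prod.mk.injEq] at h ⊢; tauto

theorem refl_injective : Function.Injective refl := by
  rintro ⟨a, b, c, d⟩ ⟨a', b', c', d'⟩ h
  simp only [refl, Prod.mk.injEq] at h ⊢; tauto

theorem rot_mem_comps {n : ℕ} : ∀ t ∈ comps n, rot t ∈ comps n := by
  rintro ⟨a, b, c, d⟩ h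
  simp only [rot, mem_comps] at *; omega

theorem refl_mem_comps {n : ℕ} : ∀ t ∈ comps n, refl t ∈ comps n := by
  rintro ⟨a, b, c, d⟩ h
  simp only [refl, mem_comps] at *; omega

theorem weight_rot (t : ℕ × ℕ × ℕ × ℕ) : weight (rot t) = weight t := by
  simp only [weight, rot]; ring

theorem weight_refl (t : ℕ × ℕ × ℕ × ℕ) : weight (refl t) = weight t := by
  simp only [weight, refl]; ring

theorem sum_biUnion_le {ι α : Type*} [DecidableEq α] (s : Finset ι) (t : ι → Finset α)
    (f : α → ℕ) : ∑ x ∈ s.biUnion t, f x ≤ ∑ i ∈ s, ∑ x ∈ t i, f x := by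
  classical
  induction s using Finset.induction_on with
  | empty => simp
  | insert i s hi ih =>
    rw [Finset.biUnion_insert, Finset.sum_insert hi]
    have := Finset.sum_union_inter (s₁ := t i) (s₂ := s.biUnion t) (f := f)
    omega

/-- Union bound over four rotations, each with or without a reflection. -/
theorem sum_criticalUpToSymm_le (n : ℕ) :
    ∑ t ∈ (comps n).filter (CriticalUpToSymm n), weight t ≤
      8 * ∑ t ∈ (comps n).filter (Critical n), weight t := by
  set S := ∑ t ∈ (comps n).filter (Critical n), weight t
  have h2 : ∑ t ∈ (comps n).filter (fun t => Critical n t ∨ Critical n (refl t)), weight t ≤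
      2 * S := by
    rw [Finset.filter_or]
    have := sum_filter_comp_le (n := n) refl_injective refl_mem_comps weight_refl (Critical n)
    have h := Finset.sum_union_inter (s₁ := (comps n).filter (Critical n))
      (s₂ := (comps n).filter fun t => Critical n (refl t)) (f := weight)
    omega
  have hi : ∀ i ∈ Finset.range 4, ∑ t ∈ (comps n).filter
      (fun t => Critical n (rot^[i] t) ∨ Critical n (refl (rot^[i] t))), weight t ≤ 2 * S := by
    intro i hi
    clear hi
    refine le_trans (sum_filter_comp_le (n := n) (rot_injective.iterate i) ?_ ?_
      (fun t => Critical n t ∨ Critical n (refl t))) h2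
    · intro t ht
      induction i with
      | zero => exact ht
      | succ i ih => rw [Function.iterate_succ_apply']; exact rot_mem_comps _ ih
    · intro t
      induction i with
      | zero => rfl
      | succ i ih => rw [Function.iterate_succ_apply', weight_rot, ih]
  calc _ ≤ ∑ t ∈ (Finset.range 4).biUnion fun i => (comps n).filter
        (fun t => Critical n (rot^[i] t) ∨ Critical n (refl (rot^[i] t))), weight t := by
        refine Finset.sum_le_sum_of_subset fun t ht => ?_
        obtain ⟨ht, i, hi, h⟩ := Finset.mem_filter.1 ht
        exact Finset.mem_biUnion.2 ⟨i, hi, Finset.mem_filter.2 ⟨ht, h⟩⟩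
    _ ≤ ∑ i ∈ Finset.range 4, ∑ t ∈ (comps n).filter
        (fun t => Critical n (rot^[i] t) ∨ Critical n (refl (rot^[i] t))), weight t :=
        sum_biUnion_le _ _ _
    _ ≤ ∑ i ∈ Finset.range 4, 2 * S := Finset.sum_le_sum hi
    _ = 8 * S := by simp; ring

/-- The vertices of the quadrilaterals whose arcs are critical up to symmetry. -/
def criticalQuads (n : ℕ) : Finset (ℕ × ℕ × ℕ × ℕ) :=
  (Finset.range n ×ˢ Finset.range n ×ˢ Finset.range n ×ˢ Finset.range n).filter
    (fun q => q.1 < q.2.1 ∧ q.2.1 < q.2.2.1 ∧ q.2.2.1 < q.2.2.2 ∧ CriticalUpToSymm n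
      (q.2.1 - q.1, q.2.2.1 - q.2.1, q.2.2.2 - q.2.2.1, n - (q.2.2.2 - q.1)))

-- Every edge of the cut is a flip in a critical quadrilateral. A quadrilateral lies in 2 · `weight`
-- triangulations, each with at most one flip there, and is given by its first vertex and its arcs;
-- 16 is this 2 times the 8 symmetries.
open Classical in
theorem card_interedges_thick_le (n : ℕ) :
    ((flipGraph n).interedges (thick n) (thick n)ᶜ).card ≤
      n * (16 * ∑ t ∈ (comps n).filter (Critical n), weight t) := by
  have hmem : ∀ {q : ℕ × ℕ × ℕ × ℕ}, q ∈ criticalQuads n → q.1 < q.2.1 ∧ q.2.1 < q.2.2.1 ∧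
      q.2.2.1 < q.2.2.2 ∧ q.2.2.2 < n ∧ CriticalUpToSymm n
      (q.2.1 - q.1, q.2.2.1 - q.2.1, q.2.2.2 - q.2.2.1, n - (q.2.2.2 - q.1)) := by
    rintro ⟨a, b, c, d⟩ h
    simp only [criticalQuads, Finset.mem_filter, Finset.mem_product, Finset.mem_range] at h
    exact ⟨h.2.1, h.2.2.1, h.2.2.2.1, h.1.2.2.2, h.2.2.2.2⟩
  let E : Finset (OPT n × OPT n) := (flipGraph n).interedges (thick n) (thick n)ᶜ
  let φ : ℕ × ℕ × ℕ × ℕ → ℕ × ℕ × ℕ × ℕ × ℕ := fun q =>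
    (q.1, q.2.1 - q.1, q.2.2.1 - q.2.1, q.2.2.2 - q.2.2.1, n - (q.2.2.2 - q.1))
  calc E.card ≤ ((criticalQuads n).biUnion fun q => E.filter fun p =>
        FlipAt n q.1 q.2.1 q.2.2.1 q.2.2.2 p.1.1 p.2.1).card := by
        refine Finset.card_le_card ?_
        rintro ⟨T, T'⟩ hTT'
        obtain ⟨h1, h2, hadj⟩ := SimpleGraph.mem_interedges_iff _ |>.1 hTT'
        obtain ⟨a, b, c, d, hab, hbc, hcd, hd, hfl⟩ := exists_flipAt hadj
        rw [Finset.mem_compl, mem_thick] at h2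
        refine Finset.mem_biUnion.2 ⟨(a, b, c, d), ?_, Finset.mem_filter.2 ⟨hTT', hfl⟩⟩
        refine Finset.mem_filter.2 ⟨?_, hab, hbc, hcd,
          hfl.critical hab hbc hcd hd T.2 (mem_thick.1 h1) h2⟩
        simp only [Finset.mem_product, Finset.mem_range]; omega
    _ ≤ ∑ q ∈ criticalQuads n, (E.filter fun p =>
        FlipAt n q.1 q.2.1 q.2.2.1 q.2.2.2 p.1.1 p.2.1).card := Finset.card_biUnion_le
    _ ≤ ∑ q ∈ criticalQuads n, 2 * weight (φ q).2 := by
        refine Finset.sum_le_sum fun q hq => ?_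
        obtain ⟨hab, hbc, hcd, hd, -⟩ := hmem hq
        rw [weight, ← card_optWith_quadrilateral hab hbc hcd hd]
        refine Finset.card_le_card_of_injOn Prod.fst ?_ ?_
        · intro p hp
          exact mem_optWith.2 (Finset.mem_filter.1 hp).2.1
        · rintro ⟨T, T₁⟩ h₁ ⟨T', T₂⟩ h₂ (rfl : T = T')
          exact Prod.ext rfl (Subtype.ext (FlipAt.right_unique hab hbc hcd T.2
            (Finset.mem_filter.1 h₁).2 (Finset.mem_filter.1 h₂).2))
    _ = ∑ u ∈ (criticalQuads n).image φ, 2 * weight u.2 := by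
        rw [Finset.sum_image]
        rintro ⟨a, b, c, d⟩ h ⟨a', b', c', d'⟩ h' heq
        obtain ⟨h1, h2, h3, h4, -⟩ := hmem h
        obtain ⟨h1', h2', h3', h4', -⟩ := hmem h'
        simp only [φ, Prod.mk.injEq] at *
        omega
    _ ≤ ∑ u ∈ Finset.range n ×ˢ (comps n).filter (CriticalUpToSymm n), 2 * weight u.2 := by
        refine Finset.sum_le_sum_of_subset fun u hu => ?_
        obtain ⟨⟨a, b, c, d⟩, h, rfl⟩ := Finset.mem_image.1 hu
        obtain ⟨h1, h2, h3, h4, h5⟩ := hmem h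
        refine Finset.mem_product.2 ⟨?_, Finset.mem_filter.2 ⟨?_, h5⟩⟩
        · simp only [φ, Finset.mem_range] at *; omega
        · simp only [φ, mem_comps] at *; omega
    _ = n * (2 * ∑ t ∈ (comps n).filter (CriticalUpToSymm n), weight t) := by
        simp only [Finset.sum_product, Finset.sum_const, Finset.card_range, smul_eq_mul, Finset.mul_sum]
    _ ≤ n * (2 * (8 * ∑ t ∈ (comps n).filter (Critical n), weight t)) := by
        gcongr; exact sum_criticalUpToSymm_le n
    _ = _ := by ring

/-! ### Estimates for Catalan numbers -/

/-- Induction on the ratio of successive terms: `(2n+1)^2 (3n+4)` falls short of `4 (n+1)^2 (3n+1)`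
by exactly `n`. -/
theorem centralBinom_sq_mul_le (n : ℕ) : n.centralBinom ^ 2 * (3 * n + 1) ≤ 16 ^ n := by
  induction n with
  | zero => simp
  | succ n ih =>
    have h := Nat.succ_mul_centralBinom_succ n
    refine le_of_mul_le_mul_left ?_ (by positivity : 0 < (n + 1) ^ 2)
    calc (n + 1) ^ 2 * ((n + 1).centralBinom ^ 2 * (3 * (n + 1) + 1))
        = ((n + 1) * (n + 1).centralBinom) ^ 2 * (3 * n + 4) := by ring
      _ = n.centralBinom ^ 2 * (4 * (2 * n + 1) ^ 2 * (3 * n + 4)) := by rw [h]; ring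
      _ ≤ n.centralBinom ^ 2 * (16 * (n + 1) ^ 2 * (3 * n + 1)) :=
          Nat.mul_le_mul_left _ (by nlinarith)
      _ = 16 * (n + 1) ^ 2 * (n.centralBinom ^ 2 * (3 * n + 1)) := by ring
      _ ≤ 16 * (n + 1) ^ 2 * 16 ^ n := by gcongr
      _ = (n + 1) ^ 2 * 16 ^ (n + 1) := by ring

/-- Induction using `4 (n+1) (n+2) ≤ (2n+3)^2`. The index is shifted because the bound fails at 0.
-/
theorem le_centralBinom_sq_mul (n : ℕ) : 16 ^ (n + 1) ≤ 4 * (n + 1) * (n + 1).centralBinom ^ 2 := by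
  induction n with
  | zero => simp [Nat.centralBinom, Nat.choose]
  | succ n ih =>
    have h := Nat.succ_mul_centralBinom_succ (n + 1)
    refine le_of_mul_le_mul_left ?_ (by positivity : 0 < (n + 1 + 1) ^ 2)
    calc (n + 1 + 1) ^ 2 * 16 ^ (n + 1 + 1) = 16 * (n + 2) ^ 2 * 16 ^ (n + 1) := by ring
      _ ≤ 16 * (n + 2) ^ 2 * (4 * (n + 1) * (n + 1).centralBinom ^ 2) := by gcongr
      _ = (n + 1).centralBinom ^ 2 * (64 * (n + 1) * (n + 2) ^ 2) := by ring
      _ ≤ (n + 1).centralBinom ^ 2 * (16 * (n + 2) * (2 * n + 3) ^ 2) :=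
          Nat.mul_le_mul_left _ (by nlinarith)
      _ = 4 * (n + 2) * (2 * (2 * (n + 1) + 1) * (n + 1).centralBinom) ^ 2 := by ring
      _ = (n + 1 + 1) ^ 2 * (4 * (n + 1 + 1) * (n + 1 + 1).centralBinom ^ 2) := by rw [← h]; ring

/-- The power `m ^ (-3/2)`. -/
noncomputable def decay (m : ℕ) : ℝ := ((m : ℝ) * √(m : ℝ))⁻¹

theorem decay_nonneg (m : ℕ) : 0 ≤ decay m := by unfold decay; positivity

theorem decay_sq (n : ℕ) : decay n ^ 2 = ((n : ℝ) ^ 3)⁻¹ := by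
  rw [decay, inv_pow, mul_pow, Real.sq_sqrt (by positivity)]; ring

theorem decay_mul_self (m : ℕ) : decay m * m = (√(m : ℝ))⁻¹ := by
  rcases Nat.eq_zero_or_pos m with rfl | hm
  · simp
  have : 0 < √(m : ℝ) := Real.sqrt_pos.2 (by exact_mod_cast hm)
  unfold decay; field_simp

theorem decay_antitone {m n : ℕ} (hm : 0 < m) (h : m ≤ n) : decay n ≤ decay m := by
  have : 0 < √(m : ℝ) := Real.sqrt_pos.2 (by exact_mod_cast hm)
  have : (m : ℝ) ≤ n := by exact_mod_cast h
  unfold decay; gcongr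

theorem cat_mul_self {m : ℕ} (hm : 0 < m) : (m : ℝ) * cat m = (m - 1).centralBinom := by
  obtain ⟨k, rfl⟩ := Nat.exists_eq_succ_of_ne_zero hm.ne'
  have := succ_mul_catalan_eq_centralBinom k
  rw [cat, Nat.succ_sub_one]
  exact_mod_cast this

theorem cat_eq {m : ℕ} (hm : 0 < m) :
    (cat m : ℝ) = ((m - 1).centralBinom * √(m : ℝ)) * decay m := by
  have hm' : (0 : ℝ) < m := by exact_mod_cast hm
  have : 0 < √(m : ℝ) := Real.sqrt_pos.2 hm'
  rw [← cat_mul_self hm, decay]; field_simp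

/-- `m * cat m` is the central binomial coefficient at `m - 1`, which is `4 ^ m / √m` up to
constants; `le_cat` is the matching lower bound. -/
theorem cat_le {m : ℕ} (hm : 0 < m) : (cat m : ℝ) ≤ 4 ^ m * decay m := by
  rw [cat_eq hm]
  refine mul_le_mul_of_nonneg_right ?_ (decay_nonneg m)
  refine le_of_sq_le_sq ?_ (by positivity)
  obtain ⟨k, rfl⟩ := Nat.exists_eq_succ_of_ne_zero hm.ne'
  rw [mul_pow, Real.sq_sqrt (by positivity), Nat.succ_sub_one]
  have h : ((k.centralBinom ^ 2 * (3 * k + 1) : ℕ) : ℝ) ≤ ((16 ^ k : ℕ) : ℝ) := by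
    exact_mod_cast centralBinom_sq_mul_le k
  push_cast at h ⊢
  have h2 : ((4 : ℝ) ^ (k + 1)) ^ 2 = 16 * 16 ^ k := by
    rw [← pow_mul, mul_comm, pow_mul]; norm_num; ring
  have h3 : (0 : ℝ) < 16 ^ k := by positivity
  rw [h2]
  nlinarith [mul_nonneg (sq_nonneg (k.centralBinom : ℝ)) (Nat.cast_nonneg k : (0 : ℝ) ≤ k)]

theorem le_cat {m : ℕ} (hm : 0 < m) : 4 ^ m * decay m / 8 ≤ (cat m : ℝ) := by
  rw [cat_eq hm, mul_div_right_comm]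
  refine mul_le_mul_of_nonneg_right ?_ (decay_nonneg m)
  refine le_of_sq_le_sq ?_ (by positivity)
  obtain ⟨k, rfl⟩ := Nat.exists_eq_succ_of_ne_zero hm.ne'
  rw [mul_pow, Real.sq_sqrt (by positivity), Nat.succ_sub_one]
  have h2 : ((4 : ℝ) ^ (k + 1) / 8) ^ 2 = 16 ^ k / 4 := by
    rw [div_pow, ← pow_mul, mul_comm, pow_mul]; norm_num; ring
  rw [Nat.succ_eq_add_one, h2]
  rcases k with _ | k
  · norm_num
  have h : ((16 ^ (k + 1) : ℕ) : ℝ) ≤ ((4 * (k + 1) * (k + 1).centralBinom ^ 2 : ℕ) : ℝ) := by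
    exact_mod_cast le_centralBinom_sq_mul k
  push_cast at h ⊢
  nlinarith [sq_nonneg ((k + 1).centralBinom : ℝ)]

/-! ### The number of edges between thick and thin triangulations -/

theorem sum_inv_sqrt_le (n : ℕ) : ∑ w ∈ Finset.Icc 1 n, (√(w : ℝ))⁻¹ ≤ 2 * √(n : ℝ) := by
  induction n with
  | zero => simp
  | succ n ih =>
    rw [Finset.sum_Icc_succ_top (by omega)]
    have h1 : √((n : ℝ) + 1) ^ 2 = n + 1 := Real.sq_sqrt (by positivity)
    have h2 : √(n : ℝ) ^ 2 = n := Real.sq_sqrt (by positivity)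
    have h3 : 0 < √((n : ℝ) + 1) := Real.sqrt_pos.2 (by positivity)
    -- The telescoping comparison of `1 / √(n+1)` with the increment of `2√n`.
    have h4 : (√((n : ℝ) + 1))⁻¹ ≤ 2 * √((n : ℝ) + 1) - 2 * √(n : ℝ) := by
      rw [inv_le_iff_one_le_mul₀ h3]
      nlinarith [sq_nonneg (√((n : ℝ) + 1) - √(n : ℝ))]
    push_cast
    linarith

theorem sqrt_le_mul_sqrt {n x : ℕ} {c d : ℝ} (hd : 0 ≤ d) (hcd : c ≤ d ^ 2)
    (h : (n : ℝ) ≤ c * x) : √(n : ℝ) ≤ d * √(x : ℝ) := by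
  rw [Real.sqrt_le_left (by positivity), mul_pow, Real.sq_sqrt (by positivity)]
  exact h.trans (by gcongr)

/-- For `x ≥ n / c` the loss is `c ^ (3/2)`; `d` is a rational upper bound for `√c`. -/
theorem decay_le_mul {n x : ℕ} {c d : ℝ} (hn : 0 < n) (hc : 0 ≤ c) (hd : 0 ≤ d) (hcd : c ≤ d ^ 2)
    (h : (n : ℝ) ≤ c * x) : decay x ≤ c * d * decay n := by
  have hn' : (0 : ℝ) < n := by exact_mod_cast hn
  have hx : (0 : ℝ) < x := by
    by_contra hx
    nlinarith [mul_nonpos_of_nonneg_of_nonpos hc (not_lt.1 hx)]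
  have h1 := sqrt_le_mul_sqrt hd hcd h
  have h2 : 0 < √(n : ℝ) := Real.sqrt_pos.2 hn'
  have h3 : 0 < √(x : ℝ) := Real.sqrt_pos.2 hx
  rw [decay, decay, inv_le_iff_one_le_mul₀ (by positivity)]
  have : (n : ℝ) * √(n : ℝ) ≤ c * x * (d * √(x : ℝ)) := by gcongr
  rw [← div_eq_mul_inv, div_mul_eq_mul_div, le_div_iff₀ (by positivity)]
  linarith

/-- The two arcs of order `n` contribute `n ^ (-3)` together; 1024 is the square of 32 = 10 · 3.2, a
bound for `10 ^ (3/2)`. -/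
theorem weight_le {n x y z w : ℕ} (h : (x, y, z, w) ∈ comps n) (hx : n ≤ 10 * x)
    (hy : n ≤ 10 * y) :
    (weight (x, y, z, w) : ℝ) ≤ 4 ^ n * 1024 * ((n : ℝ) ^ 3)⁻¹ * (decay z * decay w) := by
  obtain ⟨h1, h2, h3, h4, h5⟩ := mem_comps.1 h
  have key : ∀ m : ℕ, n ≤ 10 * m → decay m ≤ 32 * decay n := by
    intro m hm
    have := decay_le_mul (n := n) (x := m) (c := 10) (d := 3.2) (by omega) (by norm_num)
      (by norm_num) (by norm_num) (by exact_mod_cast hm)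
    norm_num at this; exact this
  have hxd := key x hx
  have hyd := key y hy
  have n1 := decay_nonneg x
  have n2 := decay_nonneg y
  have n3 := decay_nonneg z
  have n4 := decay_nonneg w
  have n5 := decay_nonneg n
  have c1 := cat_le h1
  have c2 := cat_le h2
  have c3 := cat_le h3
  have c4 := cat_le h4
  have e : (4 : ℝ) ^ n = 4 ^ x * 4 ^ y * 4 ^ z * 4 ^ w := by
    rw [← pow_add, ← pow_add, ← pow_add, h5]
  simp only [weight]
  push_cast
  calc (cat x * cat y * cat z * cat w : ℝ)
      ≤ (4 ^ x * decay x) * (4 ^ y * decay y) * (4 ^ z * decay z) * (4 ^ w * decay w) := by gcongr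
    _ = 4 ^ n * (decay x * decay y) * (decay z * decay w) := by rw [e]; ring
    _ ≤ 4 ^ n * ((32 * decay n) * (32 * decay n)) * (decay z * decay w) := by gcongr
    _ = 4 ^ n * 1024 * decay n ^ 2 * (decay z * decay w) := by ring
    _ = _ := by rw [decay_sq]

/-- The conditions confine `x` to the half-open interval from `N / k - w` to `N / k`. -/
theorem card_window_le (N k w : ℕ) (s : Finset ℕ) (hs : ∀ x ∈ s, k * x < N ∧ N ≤ k * (x + w)) :
    s.card ≤ w := by
  rcases s.eq_empty_or_nonempty with rfl | hne
  · simp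
  have : s ⊆ Finset.Ico (s.min' hne) (s.min' hne + w) := by
    intro x hx
    have h1 := hs x hx
    have h2 := hs _ (s.min'_mem hne)
    have h3 := s.min'_le x hx
    rw [Finset.mem_Ico]
    refine ⟨h3, Nat.lt_of_mul_lt_mul_left (a := k) (by omega)⟩
  exact (Finset.card_le_card this).trans (by simp)

/-- The conditions on the outer arcs `(z, w)` of a critical quadrilateral. -/
def criticalPairs (n : ℕ) : Finset (ℕ × ℕ) :=
  (Finset.Icc 1 n ×ˢ Finset.Icc 1 n).filter
    (fun p => n ≤ 20 * p.1 ∨ (10 * p.2 < n ∧ n ≤ 10 * (p.2 + p.1)))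

/-- For fixed `(z, w)` the arc `x` determines `y` and lies in a window of length `w` below `n / 2`;
these `w` choices turn `w ^ (-3/2)` into `w ^ (-1/2)`. -/
theorem sum_critical_decay_le (n : ℕ) :
    ∑ t ∈ (comps n).filter (Critical n), decay t.2.2.1 * decay t.2.2.2 ≤
      ∑ p ∈ criticalPairs n, decay p.1 * (√(p.2 : ℝ))⁻¹ := by
  rw [← Finset.sum_fiberwise_of_maps_to (s := (comps n).filter (Critical n))
    (t := criticalPairs n) (g := fun t => t.2.2)]
  · refine Finset.sum_le_sum fun p _ => ?_
    have hcard : (((comps n).filter (Critical n)).filter fun t => t.2.2 = p).card ≤ p.2 := by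
      rw [← Finset.card_image_of_injOn (f := fun t : ℕ × ℕ × ℕ × ℕ => t.1)]
      · refine card_window_le n 2 p.2 _ ?_
        intro x hx
        obtain ⟨⟨x', y, z, w⟩, ht, rfl⟩ := Finset.mem_image.1 hx
        simp only [Finset.mem_filter, Critical] at ht
        obtain ⟨⟨_, h⟩, rfl⟩ := ht
        exact ⟨h.2.2.1, by simp only; omega⟩
      · rintro ⟨x, y, z, w⟩ h ⟨x', y', z', w'⟩ h' heq
        rw [Finset.mem_coe, Finset.mem_filter, Finset.mem_filter, mem_comps] at h h'
        have e := h.2.trans h'.2.symm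
        simp only [Prod.mk.injEq] at heq e ⊢
        omega
    calc _ = ∑ t ∈ ((comps n).filter (Critical n)).filter fun t => t.2.2 = p,
          decay p.1 * decay p.2 := by
          refine Finset.sum_congr rfl fun t ht => ?_
          rw [← (Finset.mem_filter.1 ht).2]
      _ = (((comps n).filter (Critical n)).filter fun t => t.2.2 = p).card *
          (decay p.1 * decay p.2) := by rw [Finset.sum_const, nsmul_eq_mul]
      _ ≤ p.2 * (decay p.1 * decay p.2) := by
          have := decay_nonneg p.1
          have := decay_nonneg p.2
          gcongr
      _ = _ := by rw [← decay_mul_self]; ring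
  · rintro ⟨x, y, z, w⟩ h
    rw [Finset.mem_filter, mem_comps] at h
    obtain ⟨h, hcrit⟩ := h
    simp only [Critical] at hcrit
    simp only [criticalPairs, Finset.mem_filter, Finset.mem_product, Finset.mem_Icc]
    omega

theorem sum_criticalPairs_le {n : ℕ} (hn : 0 < n) :
    ∑ p ∈ criticalPairs n, decay p.1 * (√(p.2 : ℝ))⁻¹ ≤ 189 := by
  have hn' : (0 : ℝ) < n := by exact_mod_cast hn
  have hs : 0 < √(n : ℝ) := Real.sqrt_pos.2 hn'
  have hss : √(n : ℝ) * √(n : ℝ) = n := Real.mul_self_sqrt hn'.le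
  have hterm : ∀ p : ℕ × ℕ, 0 ≤ decay p.1 * (√(p.2 : ℝ))⁻¹ := fun p =>
    mul_nonneg (decay_nonneg _) (by positivity)
  -- Range `z ≥ n / 20`: each of the `n` values of `z` contributes at most `90 n ^ (-3/2) · 2√n =
  -- 180 / n`.
  have hA : ∑ z ∈ Finset.Icc 1 n, ∑ w ∈ Finset.Icc 1 n,
      (if n ≤ 20 * z then decay z * (√(w : ℝ))⁻¹ else 0) ≤ 180 := by
    have hz : ∀ z ∈ Finset.Icc 1 n, ∑ w ∈ Finset.Icc 1 n,
        (if n ≤ 20 * z then decay z * (√(w : ℝ))⁻¹ else 0) ≤ 180 / n := by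
      intro z _
      split_ifs with h
      · have h1 : decay z ≤ 90 * decay n := by
          have := decay_le_mul (n := n) (x := z) (c := 20) (d := 4.5) hn (by norm_num)
            (by norm_num) (by norm_num) (by exact_mod_cast h)
          norm_num at this; exact this
        rw [← Finset.mul_sum]
        calc decay z * ∑ w ∈ Finset.Icc 1 n, (√(w : ℝ))⁻¹ ≤ (90 * decay n) * (2 * √(n : ℝ)) := by
              have := decay_nonneg n
              gcongr
              exact sum_inv_sqrt_le n
          _ = 180 / n := by unfold decay; field_simp; norm_num
      · simp only [Finset.sum_const_zero]; positivity
    refine (Finset.sum_le_sum hz).trans (le_of_eq ?_)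
    rw [Finset.sum_const, Nat.card_Icc, nsmul_eq_mul]
    push_cast [Nat.add_sub_cancel]
    field_simp
  -- Range `z < n / 20`: then `w ≥ n / 20` and `w` has at most `z` values, so the sum is at most
  -- `4.5 / √n` times the sum of `z ^ (-1/2)`.
  have hB : ∑ z ∈ Finset.Icc 1 n, ∑ w ∈ Finset.Icc 1 n,
      (if 20 * z < n ∧ 10 * w < n ∧ n ≤ 10 * (w + z) then decay z * (√(w : ℝ))⁻¹ else 0) ≤ 9 := by
    have hz : ∀ z ∈ Finset.Icc 1 n, ∑ w ∈ Finset.Icc 1 n,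
        (if 20 * z < n ∧ 10 * w < n ∧ n ≤ 10 * (w + z) then decay z * (√(w : ℝ))⁻¹ else 0) ≤
        4.5 / √(n : ℝ) * (√(z : ℝ))⁻¹ := by
      intro z _
      rw [← Finset.sum_filter]
      calc _ ≤ ∑ w ∈ (Finset.Icc 1 n).filter
            (fun w => 20 * z < n ∧ 10 * w < n ∧ n ≤ 10 * (w + z)), decay z * (4.5 / √(n : ℝ)) := by
            refine Finset.sum_le_sum fun w hw => ?_
            rw [Finset.mem_filter, Finset.mem_Icc] at hw
            have h1 : n ≤ 20 * w := by omega
            have h2 := sqrt_le_mul_sqrt (n := n) (x := w) (c := 20) (d := 4.5) (by norm_num)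
              (by norm_num) (by exact_mod_cast h1)
            have hw0 : 0 < √(w : ℝ) := Real.sqrt_pos.2 (by exact_mod_cast hw.1.1)
            refine mul_le_mul_of_nonneg_left ?_ (decay_nonneg z)
            rw [inv_le_iff_one_le_mul₀ hw0, div_mul_eq_mul_div, le_div_iff₀ hs]
            linarith
        _ = ((Finset.Icc 1 n).filter
            (fun w => 20 * z < n ∧ 10 * w < n ∧ n ≤ 10 * (w + z))).card *
            (decay z * (4.5 / √(n : ℝ))) := by rw [Finset.sum_const, nsmul_eq_mul]
        _ ≤ z * (decay z * (4.5 / √(n : ℝ))) := by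
            have := decay_nonneg z
            gcongr
            refine card_window_le n 10 z _ (fun w hw => ?_)
            exact (Finset.mem_filter.1 hw).2.2
        _ = 4.5 / √(n : ℝ) * (decay z * z) := by ring
        _ = _ := by rw [decay_mul_self]
    refine (Finset.sum_le_sum hz).trans ?_
    rw [← Finset.mul_sum]
    calc _ ≤ 4.5 / √(n : ℝ) * (2 * √(n : ℝ)) := by gcongr; exact sum_inv_sqrt_le n
      _ = 9 := by field_simp; norm_num
  calc _ ≤ ∑ z ∈ Finset.Icc 1 n, ∑ w ∈ Finset.Icc 1 n,
        ((if n ≤ 20 * z then decay z * (√(w : ℝ))⁻¹ else 0) +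
        (if 20 * z < n ∧ 10 * w < n ∧ n ≤ 10 * (w + z) then decay z * (√(w : ℝ))⁻¹ else 0)) := by
        rw [criticalPairs, Finset.sum_filter, Finset.sum_product]
        refine Finset.sum_le_sum fun z _ => Finset.sum_le_sum fun w _ => ?_
        have h0 := hterm (z, w)
        simp only at h0 ⊢
        by_cases h : n ≤ 20 * z
        · have h' : ¬ 20 * z < n := by omega
          simp [h, h']
        · have h' : 20 * z < n := by omega
          simp [h, h']
    _ ≤ 180 + 9 := by simp only [Finset.sum_add_distrib]; exact add_le_add hA hB
    _ = 189 := by norm_num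

theorem card_interedges_thick_le' {n : ℕ} (hn : 0 < n) :
    (((flipGraph n).interedges (thick n) (thick n)ᶜ).card : ℝ) ≤
      (16 * 1024 * 189) * (4 ^ n / (n : ℝ) ^ 2) := by
  have hn' : (0 : ℝ) < n := by exact_mod_cast hn
  have h : (((flipGraph n).interedges (thick n) (thick n)ᶜ).card : ℝ) ≤
      n * (16 * ∑ t ∈ (comps n).filter (Critical n), (weight t : ℝ)) := by
    exact_mod_cast card_interedges_thick_le n
  have h2 : ∑ t ∈ (comps n).filter (Critical n), (weight t : ℝ) ≤
      4 ^ n * 1024 * ((n : ℝ) ^ 3)⁻¹ * 189 := by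
    calc _ ≤ ∑ t ∈ (comps n).filter (Critical n),
          4 ^ n * 1024 * ((n : ℝ) ^ 3)⁻¹ * (decay t.2.2.1 * decay t.2.2.2) := by
          refine Finset.sum_le_sum ?_
          rintro ⟨x, y, z, w⟩ ht
          obtain ⟨h1, h2⟩ := Finset.mem_filter.1 ht
          exact weight_le h1 h2.1 h2.2.1
      _ = 4 ^ n * 1024 * ((n : ℝ) ^ 3)⁻¹ *
          ∑ t ∈ (comps n).filter (Critical n), decay t.2.2.1 * decay t.2.2.2 := by
          rw [Finset.mul_sum]
      _ ≤ _ := by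
          gcongr
          exact (sum_critical_decay_le n).trans (sum_criticalPairs_le hn)
  calc _ ≤ _ := h
    _ ≤ n * (16 * (4 ^ n * 1024 * ((n : ℝ) ^ 3)⁻¹ * 189)) := by gcongr
    _ = _ := by field_simp

/-! ### The numbers of thick and thin triangulations -/

/-- The box consists of `k ^ 3` central triangles, given by first vertex and two arcs. All arcs are
at most `n`, so each Catalan factor is bounded below with `decay n`; 512 is the cube of the 8 in
`le_cat`. -/
theorem le_card_of_box {n : ℕ} (S : Finset (OPT n)) (P Q k : ℕ)
    (h : ∀ a p q, a < k → P ≤ p → p < P + k → Q ≤ q → q < Q + k →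
      Central n a (a + p) (a + p + q) ∧ optWith n (tri a (a + p) (a + p + q)) ⊆ S) :
    (k : ℝ) ^ 3 * (4 ^ n / 512 * decay n ^ 3) ≤ S.card := by
  let φ : ℕ × ℕ × ℕ → ℕ × ℕ × ℕ := fun t => (t.1, t.1 + t.2.1, t.1 + t.2.1 + t.2.2)
  let B := Finset.range k ×ˢ Finset.Ico P (P + k) ×ˢ Finset.Ico Q (Q + k)
  have hφ : Function.Injective φ := by
    rintro ⟨a, p, q⟩ ⟨a', p', q'⟩ h
    simp only [φ, Prod.mk.injEq] at h ⊢; omega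
  have hB : ∀ t ∈ B.image φ, Central n t.1 t.2.1 t.2.2 ∧ optWith n (tri t.1 t.2.1 t.2.2) ⊆ S := by
    intro t ht
    obtain ⟨⟨a, p, q⟩, hs, rfl⟩ := Finset.mem_image.1 ht
    simp only [B, Finset.mem_product, Finset.mem_range, Finset.mem_Ico] at hs
    exact h a p q hs.1 hs.2.1.1 hs.2.1.2 hs.2.2.1 hs.2.2.2
  have hsum := sum_le_card S (B.image φ) (fun t ht => (hB t ht).1) (fun t ht => (hB t ht).2)
  have hcard : (B.image φ).card = k ^ 3 := by
    rw [Finset.card_image_of_injective _ hφ]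
    simp only [B, Finset.card_product, Finset.card_range, Nat.card_Ico, Nat.add_sub_cancel_left]
    ring
  calc (k : ℝ) ^ 3 * (4 ^ n / 512 * decay n ^ 3)
      = ∑ t ∈ B.image φ, 4 ^ n / 512 * decay n ^ 3 := by
        rw [Finset.sum_const, hcard, nsmul_eq_mul]; push_cast; ring
    _ ≤ ∑ t ∈ B.image φ,
        ((cat (t.2.1 - t.1) * cat (t.2.2 - t.2.1) * cat (n - (t.2.2 - t.1)) : ℕ) : ℝ) := by
        refine Finset.sum_le_sum fun t ht => ?_
        obtain ⟨h1, h2, h3, -⟩ := (hB t ht).1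
        have hd := decay_nonneg n
        have key : ∀ m, 0 < m → m ≤ n → 4 ^ m * decay n / 8 ≤ (cat m : ℝ) := fun m hm hmn =>
          le_trans (by have := decay_antitone hm hmn; gcongr) (le_cat hm)
        have e : (4 : ℝ) ^ n = 4 ^ (t.2.1 - t.1) * 4 ^ (t.2.2 - t.2.1) *
            4 ^ (n - (t.2.2 - t.1)) := by
          rw [← pow_add, ← pow_add]; congr 1; omega
        push_cast
        calc 4 ^ n / 512 * decay n ^ 3 = (4 ^ (t.2.1 - t.1) * decay n / 8) *
              (4 ^ (t.2.2 - t.2.1) * decay n / 8) *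
              (4 ^ (n - (t.2.2 - t.1)) * decay n / 8) := by rw [e]; ring
          _ ≤ _ := by
              gcongr
              · exact key _ (by omega) (by omega)
              · exact key _ (by omega) (by omega)
              · exact key _ (by omega) (by omega)
    _ ≤ S.card := by exact_mod_cast hsum

theorem le_card_thick {n k : ℕ} (h1 : 100 * k ≤ n) (h2 : n < 101 * k) :
    (k : ℝ) ^ 3 * (4 ^ n / 512 * decay n ^ 3) ≤ (thick n).card := by
  -- With `n` about `100 k`, all three arcs lie between `32 k` and `35 k`.
  refine le_card_of_box (thick n) (33 * k) (33 * k) k fun a p q ha hp hp' hq hq' => ⟨?_, ?_⟩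
  · unfold Central; omega
  · refine optWith_subset_thick (by omega) (by omega) (by omega) ?_
    unfold ThickArcs; omega

theorem le_card_thin {n k : ℕ} (h1 : 100 * k ≤ n) (h2 : n < 101 * k) :
    (k : ℝ) ^ 3 * (4 ^ n / 512 * decay n ^ 3) ≤ ((thick n)ᶜ).card := by
  have key : ∀ a p q, a < k → 7 * k ≤ p → p < 7 * k + k → 46 * k ≤ q → q < 46 * k + k →
      Central n a (a + p) (a + p + q) := by
    intro a p q ha hp hp' hq hq'
    unfold Central; omega
  -- The first arc is below `8 k`, hence less than `n / 10`; the other two are between `45 k` and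
  -- `48 k`, hence less than `n / 2`.
  refine le_card_of_box _ (7 * k) (46 * k) k fun a p q ha hp hp' hq hq' =>
    ⟨key a p q ha hp hp' hq hq', optWith_subset_thin (key a p q ha hp hp' hq hq') ?_⟩
  unfold ThickArcs; omega

theorem cutRatio_thick_le {n : ℕ} (hn : 10000 ≤ n) : (thick n).Nonempty ∧ (thick n)ᶜ.Nonempty ∧
    cutRatio (flipGraph n) (thick n) ≤ (16 * 1024 * 189 * 512 * 101 ^ 3) * (√(n : ℝ))⁻¹ := by
  -- `n ≥ 10000` makes `k ≥ 100`, so the rounding error is below `k`.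
  obtain ⟨k, h1, h2⟩ : ∃ k, 100 * k ≤ n ∧ n < 101 * k := ⟨n / 100, by omega, by omega⟩
  have hn' : (0 : ℝ) < n := by exact_mod_cast (by omega : 0 < n)
  have hs : 0 < √(n : ℝ) := Real.sqrt_pos.2 hn'
  have hss : √(n : ℝ) ^ 2 = n := Real.sq_sqrt hn'.le
  have hnk : (n : ℝ) / 101 ≤ k := by
    rw [div_le_iff₀ (by norm_num)]; exact_mod_cast (by omega : n ≤ k * 101)
  set M : ℝ := 4 ^ n / 512 * ((101 : ℝ) ^ 3 * n * √(n : ℝ))⁻¹ with hM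
  have hM0 : 0 < M := by positivity
  have hle : M ≤ (k : ℝ) ^ 3 * (4 ^ n / 512 * decay n ^ 3) := by
    have hd := decay_nonneg n
    calc M = ((n : ℝ) / 101) ^ 3 * (4 ^ n / 512 * (decay n ^ 2 * decay n)) := by
          rw [hM, decay_sq, decay]; field_simp
      _ = ((n : ℝ) / 101) ^ 3 * (4 ^ n / 512 * decay n ^ 3) := by ring
      _ ≤ _ := by gcongr
  have ht := hle.trans (le_card_thick h1 h2)
  have ht' := hle.trans (le_card_thin h1 h2)
  refine ⟨Finset.card_pos.1 (by exact_mod_cast hM0.trans_le ht),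
    Finset.card_pos.1 (by exact_mod_cast hM0.trans_le ht'), ?_⟩
  calc cutRatio (flipGraph n) (thick n)
      ≤ ((16 * 1024 * 189) * (4 ^ n / (n : ℝ) ^ 2)) / M := by
        unfold cutRatio
        gcongr
        · exact card_interedges_thick_le' (by omega)
        · exact le_min ht ht'
    _ = (16 * 1024 * 189 * 512 * 101 ^ 3) * (√(n : ℝ) ^ 2 / n * (√(n : ℝ))⁻¹) := by
        rw [hM]; field_simp
    _ = _ := by rw [hss, div_self hn'.ne', one_mul]

/-! ### Cuts, the spectral gap and the mixing time of a graph -/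

section Cut

set_option linter.unusedSectionVars false

variable {V : Type*} [Fintype V] [DecidableEq V] (G : SimpleGraph V) [DecidableRel G.Adj]

/-- `E(S, Sᶜ) / min(vol S, vol Sᶜ)`. -/
noncomputable def volRatio (S : Finset V) : ℝ :=
  ((G.interedges S Sᶜ).card : ℝ) / min (vol G S : ℝ) (vol G Sᶜ : ℝ)

theorem cutRatio_nonneg (S : Finset V) : 0 ≤ cutRatio G S := by unfold cutRatio; positivity

theorem volRatio_nonneg (S : Finset V) : 0 ≤ volRatio G S := by unfold volRatio; positivity

theorem isoperimetricConstant_le {S : Finset V} (h : S.Nonempty) (h' : Sᶜ.Nonempty) :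
    isoperimetricConstant G ≤ cutRatio G S :=
  ciInf_le (f := fun S : {S : Finset V // S.Nonempty ∧ Sᶜ.Nonempty} => cutRatio G S.1)
    ⟨0, by rintro _ ⟨S, rfl⟩; exact cutRatio_nonneg G S.1⟩ ⟨S, h, h'⟩

theorem cheegerConstant_le {S : Finset V} (h : S.Nonempty) (h' : Sᶜ.Nonempty) :
    cheegerConstant G ≤ volRatio G S :=
  ciInf_le (f := fun S : {S : Finset V // S.Nonempty ∧ Sᶜ.Nonempty} => volRatio G S.1)
    ⟨0, by rintro _ ⟨S, rfl⟩; exact volRatio_nonneg G S.1⟩ ⟨S, h, h'⟩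

theorem mul_card_le_vol {d : ℕ} (hd : ∀ v, d ≤ G.degree v) (S : Finset V) :
    d * S.card ≤ vol G S := by
  rw [vol, mul_comm, ← smul_eq_mul]
  exact Finset.card_nsmul_le_sum _ _ _ fun v _ => hd v

theorem volRatio_le_cutRatio_div {d : ℕ} (hd : ∀ v, d ≤ G.degree v) (hd0 : 0 < d) {S : Finset V}
    (h : S.Nonempty) (h' : Sᶜ.Nonempty) : volRatio G S ≤ cutRatio G S / d := by
  have h1 : (d : ℝ) * S.card ≤ vol G S := by exact_mod_cast mul_card_le_vol G hd S
  have h2 : (d : ℝ) * (Sᶜ.card : ℝ) ≤ vol G Sᶜ := by exact_mod_cast mul_card_le_vol G hd Sᶜ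
  have h3 : (0 : ℝ) < S.card := by exact_mod_cast h.card_pos
  have h4 : (0 : ℝ) < (Sᶜ.card : ℝ) := by exact_mod_cast h'.card_pos
  have h5 : (0 : ℝ) < d := by exact_mod_cast hd0
  rw [cutRatio, volRatio, div_div]
  have : 0 < min (S.card : ℝ) (Sᶜ.card : ℝ) := lt_min h3 h4
  gcongr
  rw [mul_comm]
  exact le_min ((mul_le_mul_of_nonneg_left (min_le_left _ _) h5.le).trans h1)
    ((mul_le_mul_of_nonneg_left (min_le_right _ _) h5.le).trans h2)

theorem card_interedges_eq_sum (S T : Finset V) :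
    ((G.interedges S T).card : ℝ) = ∑ v ∈ S, ∑ w ∈ T, if G.Adj v w then (1 : ℝ) else 0 := by
  rw [← Finset.sum_product' (f := fun v w => if G.Adj v w then (1 : ℝ) else 0), ← Finset.sum_filter,
    Finset.sum_const, nsmul_eq_mul, mul_one]
  rfl

theorem cast_vol (S : Finset V) : (vol G S : ℝ) = ∑ v ∈ S, (G.degree v : ℝ) := by
  rw [vol, Nat.cast_sum]

theorem vol_pos (hdeg : ∀ v, 0 < G.degree v) {S : Finset V} (h : S.Nonempty) : 0 < vol G S :=
  Finset.sum_pos (fun v _ => hdeg v) h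

theorem vol_add_vol_compl (S : Finset V) : vol G S + vol G Sᶜ = vol G Finset.univ :=
  Finset.sum_add_sum_compl S _

theorem card_interedges_compl_comm (S : Finset V) :
    (G.interedges Sᶜ S).card = (G.interedges S Sᶜ).card := by
  have := G.symm
  exact Rel.card_interedges_comm (r := G.Adj) Sᶜ S

/-- The easy half of Cheeger's inequality. The function equal to `vol Sᶜ` on `S` and `-vol S` on
`Sᶜ` is orthogonal to constants, with Rayleigh quotient `E (a + b) / (a b)`, at most `2 E / min a
b`. -/
theorem spectralGap_le (hdeg : ∀ v, 0 < G.degree v) {S : Finset V} (h : S.Nonempty)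
    (h' : Sᶜ.Nonempty) : spectralGap G ≤ 2 * volRatio G S := by
  set a : ℝ := ((vol G S : ℕ) : ℝ) with ha
  set b : ℝ := ((vol G Sᶜ : ℕ) : ℝ) with hb
  have ha0 : 0 < a := by rw [ha]; exact_mod_cast vol_pos G hdeg h
  have hb0 : 0 < b := by rw [hb]; exact_mod_cast vol_pos G hdeg h'
  have ha' : ∑ v ∈ S, (G.degree v : ℝ) = a := by rw [ha, cast_vol]
  have hb' : ∑ v ∈ Sᶜ, (G.degree v : ℝ) = b := by rw [hb, cast_vol]
  set E : ℝ := ((G.interedges S Sᶜ).card : ℝ) with hE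
  have hE' : ((G.interedges Sᶜ S).card : ℝ) = E := by rw [hE, card_interedges_compl_comm]
  let f : V → ℝ := fun v => if v ∈ S then b else -a
  have fS : ∀ v ∈ S, f v = b := fun v hv => if_pos hv
  have fSc : ∀ v ∈ Sᶜ, f v = -a := fun v hv => if_neg (Finset.mem_compl.1 hv)
  have hf0 : f ≠ 0 := by
    obtain ⟨v, hv⟩ := h
    intro h0
    have := congrFun h0 v
    rw [fS v hv] at this
    exact hb0.ne' this
  have hforth : ∑ v, (G.degree v : ℝ) * f v = 0 := by
    rw [← Finset.sum_add_sum_compl S,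
      Finset.sum_congr rfl fun v hv => by rw [fS v hv],
      Finset.sum_congr (s₁ := Sᶜ) rfl fun v hv => by rw [fSc v hv],
      ← Finset.sum_mul, ← Finset.sum_mul, ha', hb']
    ring
  have hden : ∑ v, (G.degree v : ℝ) * f v ^ 2 = a * b * (a + b) := by
    rw [← Finset.sum_add_sum_compl S,
      Finset.sum_congr rfl fun v hv => by rw [fS v hv],
      Finset.sum_congr (s₁ := Sᶜ) rfl fun v hv => by rw [fSc v hv],
      ← Finset.sum_mul, ← Finset.sum_mul, ha', hb']
    ring
  have hblock : ∀ (A B : Finset V) (x y : ℝ), (∀ v ∈ A, f v = x) → (∀ v ∈ B, f v = y) →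
      ∑ v ∈ A, ∑ w ∈ B, (if G.Adj v w then (f v - f w) ^ 2 else 0) =
        (x - y) ^ 2 * (G.interedges A B).card := by
    intro A B x y hx hy
    rw [card_interedges_eq_sum, Finset.mul_sum]
    refine Finset.sum_congr rfl fun v hv => ?_
    rw [Finset.mul_sum]
    refine Finset.sum_congr rfl fun w hw => ?_
    rw [hx v hv, hy w hw, mul_ite, mul_one, mul_zero]
  have hnum : ∑ v, ∑ w, (if G.Adj v w then (f v - f w) ^ 2 else 0) = 2 * E * (a + b) ^ 2 := by
    rw [← Finset.sum_add_sum_compl S]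
    simp_rw [← Finset.sum_add_sum_compl S (fun w => if G.Adj _ w then (f _ - f w) ^ 2 else 0)]
    rw [Finset.sum_add_distrib, Finset.sum_add_distrib, hblock S S b b fS fS,
      hblock S Sᶜ b (-a) fS fSc, hblock Sᶜ S (-a) b fSc fS, hblock Sᶜ Sᶜ (-a) (-a) fSc fSc, hE',
      ← hE]
    ring
  have hle : spectralGap G ≤ ((1 / 2) * ∑ v, ∑ w, if G.Adj v w then (f v - f w) ^ 2 else 0) /
      ∑ v, (G.degree v : ℝ) * f v ^ 2 := by
    refine ciInf_le (f := fun f : {f : V → ℝ // f ≠ 0 ∧ ∑ v, (G.degree v : ℝ) * f v = 0} =>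
      ((1 / 2) * ∑ v, ∑ w, if G.Adj v w then (f.1 v - f.1 w) ^ 2 else 0) /
        ∑ v, (G.degree v : ℝ) * f.1 v ^ 2) ⟨0, ?_⟩ ⟨f, hf0, hforth⟩
    rintro _ ⟨g, rfl⟩
    have : ∀ v w, 0 ≤ if G.Adj v w then (g.1 v - g.1 w) ^ 2 else 0 := fun v w => by
      split_ifs <;> positivity
    refine div_nonneg (mul_nonneg (by norm_num) (Finset.sum_nonneg fun v _ =>
      Finset.sum_nonneg fun w _ => this v w)) (Finset.sum_nonneg fun v _ => by positivity)
  refine hle.trans ?_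
  rw [hnum, hden, volRatio, ← hE, ← ha, ← hb, mul_div_assoc', div_le_div_iff₀ (by positivity)
    (lt_min ha0 hb0)]
  have hE0 : 0 ≤ E := by rw [hE]; positivity
  have hm : min a b * (a + b) ≤ 2 * (a * b) := by
    rcases le_total a b with hab | hab
    · rw [min_eq_left hab]; nlinarith
    · rw [min_eq_right hab]; nlinarith
  nlinarith [mul_le_mul_of_nonneg_left hm (mul_nonneg hE0 (add_pos ha0 hb0).le)]

/-! ### The simple random walk and its escape from a set -/

theorem walkMatrix_nonneg (v w : V) : 0 ≤ walkMatrix G v w := by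
  rw [walkMatrix, Matrix.of_apply]; split_ifs <;> positivity

theorem walkMatrix_pow_nonneg (t : ℕ) (v w : V) : 0 ≤ (walkMatrix G ^ t) v w := by
  induction t generalizing w with
  | zero => rw [pow_zero, Matrix.one_apply]; split_ifs <;> norm_num
  | succ t ih =>
    rw [pow_succ, Matrix.mul_apply]
    exact Finset.sum_nonneg fun u _ => mul_nonneg (ih u) (walkMatrix_nonneg G u w)

theorem degree_mul_walkMatrix (v w : V) :
    (G.degree v : ℝ) * walkMatrix G v w = if G.Adj v w then 1 else 0 := by
  rw [walkMatrix, Matrix.of_apply]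
  split_ifs with h
  · have : 0 < G.degree v := (G.degree_pos_iff_exists_adj v).2 ⟨w, h⟩
    exact mul_inv_cancel₀ (by exact_mod_cast this.ne')
  · simp

theorem sum_adj (v : V) : ∑ w, (if G.Adj v w then (1 : ℝ) else 0) = G.degree v := by
  rw [← Finset.sum_filter, Finset.sum_const, nsmul_eq_mul, mul_one,
    ← SimpleGraph.card_neighborFinset_eq_degree]
  congr 2; ext w; simp

theorem sum_walkMatrix (hdeg : ∀ v, 0 < G.degree v) (v : V) : ∑ w, walkMatrix G v w = 1 := by
  have h : (0 : ℝ) < G.degree v := by exact_mod_cast hdeg v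
  refine mul_left_cancel₀ h.ne' ?_
  rw [Finset.mul_sum]
  simp_rw [degree_mul_walkMatrix]
  rw [sum_adj, mul_one]

theorem sum_walkMatrix_pow (hdeg : ∀ v, 0 < G.degree v) (t : ℕ) (v : V) :
    ∑ w, (walkMatrix G ^ t) v w = 1 := by
  induction t with
  | zero => simp [Matrix.one_apply]
  | succ t ih =>
    simp_rw [pow_succ, Matrix.mul_apply]
    rw [Finset.sum_comm]
    simp_rw [← Finset.mul_sum, sum_walkMatrix G hdeg, mul_one, ih]

/-- The valence measure is stationary, because degree times transition probability is the symmetric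
adjacency matrix. -/
theorem sum_degree_mul_walkMatrix_pow (t : ℕ) (u : V) :
    ∑ v, (G.degree v : ℝ) * (walkMatrix G ^ t) v u = G.degree u := by
  induction t generalizing u with
  | zero => simp [Matrix.one_apply]
  | succ t ih =>
    simp_rw [pow_succ, Matrix.mul_apply, Finset.mul_sum]
    rw [Finset.sum_comm]
    simp_rw [← mul_assoc, ← Finset.sum_mul, ih, degree_mul_walkMatrix]
    rw [← sum_adj]
    exact Finset.sum_congr rfl fun w _ => by simp only [G.adj_comm]

/-- In `t` steps at most `t * E(S, Sᶜ)` of the valence-weighted mass leaves `S`. -/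
theorem escape_le (hdeg : ∀ v, 0 < G.degree v) (S : Finset V) (t : ℕ) :
    ∑ v ∈ S, ∑ w ∈ Sᶜ, (G.degree v : ℝ) * (walkMatrix G ^ t) v w ≤
      t * (G.interedges S Sᶜ).card := by
  have hcomm : ∀ t, ∑ v ∈ S, ∑ w ∈ Sᶜ, (G.degree v : ℝ) * (walkMatrix G ^ t) v w =
      ∑ w ∈ Sᶜ, ∑ v ∈ S, (G.degree v : ℝ) * (walkMatrix G ^ t) v w :=
    fun t => Finset.sum_comm
  rw [hcomm]
  induction t with
  | zero =>
    rw [← hcomm]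
    refine le_of_eq ?_
    rw [Nat.cast_zero, zero_mul]
    refine Finset.sum_eq_zero fun v hv => Finset.sum_eq_zero fun w hw => ?_
    have : v ≠ w := fun h => Finset.mem_compl.1 hw (h ▸ hv)
    rw [pow_zero, Matrix.one_apply_ne this, mul_zero]
  | succ t ih =>
    -- The mass at `u` after `t` steps when the start is the valence measure on `S`; by stationarity
    -- it never exceeds the degree of `u`.
    set m : V → ℝ := fun u => ∑ v ∈ S, (G.degree v : ℝ) * (walkMatrix G ^ t) v u with hm
    have hm0 : ∀ u, 0 ≤ m u := fun u => Finset.sum_nonneg fun v _ =>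
      mul_nonneg (Nat.cast_nonneg _) (walkMatrix_pow_nonneg G t v u)
    have hmdeg : ∀ u, m u ≤ G.degree u := fun u => by
      rw [← sum_degree_mul_walkMatrix_pow G t u]
      exact Finset.sum_le_univ_sum_of_nonneg fun v =>
        mul_nonneg (Nat.cast_nonneg _) (walkMatrix_pow_nonneg G t v u)
    calc ∑ w ∈ Sᶜ, ∑ v ∈ S, (G.degree v : ℝ) * (walkMatrix G ^ (t + 1)) v w
        = ∑ w ∈ Sᶜ, ∑ u, m u * walkMatrix G u w := by
          refine Finset.sum_congr rfl fun w _ => ?_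
          simp_rw [pow_succ, Matrix.mul_apply, Finset.mul_sum, hm, Finset.sum_mul]
          rw [Finset.sum_comm]
          exact Finset.sum_congr rfl fun u _ => Finset.sum_congr rfl fun v _ => by ring
      _ = ∑ u ∈ S, ∑ w ∈ Sᶜ, m u * walkMatrix G u w +
          ∑ u ∈ Sᶜ, ∑ w ∈ Sᶜ, m u * walkMatrix G u w := by
          rw [Finset.sum_comm, Finset.sum_add_sum_compl]
      -- Mass outside `S` either crosses in the last step, at most one unit for each edge of the
      -- cut, or was outside before.
      _ ≤ ∑ u ∈ S, ∑ w ∈ Sᶜ, (if G.Adj u w then (1 : ℝ) else 0) + ∑ u ∈ Sᶜ, m u := by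
          refine add_le_add ?_ ?_
          · refine Finset.sum_le_sum fun u _ => Finset.sum_le_sum fun w _ => ?_
            rw [← degree_mul_walkMatrix]
            exact mul_le_mul_of_nonneg_right (hmdeg u) (walkMatrix_nonneg G u w)
          · refine Finset.sum_le_sum fun u _ => ?_
            rw [← Finset.mul_sum]
            refine mul_le_of_le_one_right (hm0 u) ?_
            rw [← sum_walkMatrix G hdeg u]
            exact Finset.sum_le_univ_sum_of_nonneg fun w => walkMatrix_nonneg G u w
      _ ≤ (G.interedges S Sᶜ).card + t * (G.interedges S Sᶜ).card := by
          rw [← card_interedges_eq_sum]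
          exact add_le_add le_rfl ih
      _ = _ := by push_cast; ring

theorem sum_stationary [Nonempty V] (hdeg : ∀ v, 0 < G.degree v) : ∑ v, stationary G v = 1 := by
  have h : (0 : ℝ) < vol G Finset.univ := by exact_mod_cast vol_pos G hdeg Finset.univ_nonempty
  simp_rw [stationary]
  rw [← Finset.sum_div, div_eq_one_iff_eq h.ne', cast_vol]

/-- Both distributions have total mass 1, so a deficit on `A` is matched by an equal excess on `Aᶜ`,
and half the absolute sum covers it. -/
theorem sum_sub_le_tvDist (hdeg : ∀ v, 0 < G.degree v) (t : ℕ) (v : V) (A : Finset V) :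
    ∑ w ∈ A, (stationary G w - (walkMatrix G ^ t) v w) ≤ tvDist G t v := by
  have : Nonempty V := ⟨v⟩
  have h0 : ∑ w ∈ A, (stationary G w - (walkMatrix G ^ t) v w) +
      ∑ w ∈ Aᶜ, (stationary G w - (walkMatrix G ^ t) v w) = 0 := by
    rw [Finset.sum_add_sum_compl, Finset.sum_sub_distrib, sum_stationary G hdeg,
      sum_walkMatrix_pow G hdeg, sub_self]
  have h1 : ∑ w ∈ A, (stationary G w - (walkMatrix G ^ t) v w) ≤
      ∑ w ∈ A, |(walkMatrix G ^ t) v w - stationary G w| :=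
    Finset.sum_le_sum fun w _ => by rw [abs_sub_comm]; exact le_abs_self _
  have h2 : -∑ w ∈ Aᶜ, (stationary G w - (walkMatrix G ^ t) v w) ≤
      ∑ w ∈ Aᶜ, |(walkMatrix G ^ t) v w - stationary G w| := by
    rw [← Finset.sum_neg_distrib]
    exact Finset.sum_le_sum fun w _ => by rw [neg_sub]; exact le_abs_self _
  rw [tvDist, ← Finset.sum_add_sum_compl A]
  linarith

/-- Start from the stationary measure conditioned on `S`. At stationarity at least half of the mass
lies outside `S`, but in `t` steps at most `t * E(S, Sᶜ) / vol S` has left, and the two may differ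
by at most `ε`. -/
theorem le_mul_volRatio_of_vol_le (hdeg : ∀ v, 0 < G.degree v) {S : Finset V} (h : S.Nonempty)
    (hS : vol G S ≤ vol G Sᶜ) {t : ℕ} {ε : ℝ} (ht : ∀ v, tvDist G t v ≤ ε) :
    1 / 2 - ε ≤ t * volRatio G S := by
  have ha0 : (0 : ℝ) < vol G S := by exact_mod_cast vol_pos G hdeg h
  have hab : (vol G S : ℝ) ≤ vol G Sᶜ := by exact_mod_cast hS
  have hsum : (vol G S : ℝ) + vol G Sᶜ = vol G Finset.univ := by
    exact_mod_cast vol_add_vol_compl G S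
  have h1 : ∑ v ∈ S, (G.degree v : ℝ) * ∑ w ∈ Sᶜ, (stationary G w - (walkMatrix G ^ t) v w) ≤
      vol G S * ε := by
    rw [cast_vol, Finset.sum_mul]
    refine Finset.sum_le_sum fun v _ => ?_
    exact mul_le_mul_of_nonneg_left ((sum_sub_le_tvDist G hdeg t v Sᶜ).trans (ht v))
      (Nat.cast_nonneg _)
  have h2 : ∑ v ∈ S, (G.degree v : ℝ) * ∑ w ∈ Sᶜ, (stationary G w - (walkMatrix G ^ t) v w) =
      vol G S * (vol G Sᶜ / vol G Finset.univ) -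
        ∑ v ∈ S, ∑ w ∈ Sᶜ, (G.degree v : ℝ) * (walkMatrix G ^ t) v w := by
    have h3 : ∑ w ∈ Sᶜ, stationary G w = vol G Sᶜ / vol G Finset.univ := by
      simp_rw [stationary]
      rw [← Finset.sum_div, cast_vol G Sᶜ]
    simp_rw [Finset.sum_sub_distrib, h3, mul_sub, Finset.sum_sub_distrib, ← Finset.sum_mul, ← cast_vol,
      Finset.mul_sum]
  have h4 := escape_le G hdeg S t
  have h5 : (1 : ℝ) / 2 ≤ vol G Sᶜ / vol G Finset.univ := by
    rw [div_le_div_iff₀ (by norm_num) (by linarith)]; linarith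
  have h6 := mul_le_mul_of_nonneg_left h5 ha0.le
  rw [volRatio, min_eq_left hab, mul_div_assoc', le_div_iff₀ ha0]
  linarith

/-- A walk that is `ε`-mixed after `t` steps must have had the time to cross the bottleneck. -/
theorem le_mul_volRatio (hdeg : ∀ v, 0 < G.degree v) {S : Finset V} (h : S.Nonempty)
    (h' : Sᶜ.Nonempty) {t : ℕ} {ε : ℝ} (ht : ∀ v, tvDist G t v ≤ ε) :
    1 / 2 - ε ≤ t * volRatio G S := by
  rcases le_total (vol G S) (vol G Sᶜ) with hS | hS
  · exact le_mul_volRatio_of_vol_le G hdeg h hS ht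
  · have := le_mul_volRatio_of_vol_le G hdeg h' (by rwa [compl_compl]) ht
    rwa [volRatio, compl_compl, card_interedges_compl_comm, min_comm] at this

/-- A walk that never mixes has mixing time `⊤`, as for `n = 4`, where the graph is a single edge
and the walk is periodic; otherwise the infimum is attained. -/
theorem le_mixingTime {ε : ℝ} {c : ℝ} (h : ∀ t : ℕ, (∀ v, tvDist G t v ≤ ε) → c ≤ t) :
    ENNReal.ofReal c ≤ ((mixingTime G ε : ℕ∞) : ℝ≥0∞) := by
  rcases eq_or_ne (mixingTime G ε) ⊤ with htop | htop
  · simp [htop]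
  · have hne : {τ : ℕ∞ | ∃ t : ℕ, τ = (t : ℕ∞) ∧ ∀ v, tvDist G t v ≤ ε}.Nonempty := by
      by_contra hcon
      rw [Set.not_nonempty_iff_eq_empty] at hcon
      exact htop (by rw [mixingTime, hcon, sInf_empty])
    obtain ⟨t, ht, hmix⟩ := csInf_mem hne
    have : mixingTime G ε = (t : ℕ∞) := ht
    rw [this]
    refine ENNReal.ofReal_le_of_le_toReal ?_
    simpa using h t hmix

end Cut

/-! ### Conclusion -/

/-- An estimate for large `n` gives an estimate for all `n`. -/
theorem exists_const_of_eventually {P : ℕ → ℝ → Prop} (hP : ∀ n x y, x ≤ y → P n x → P n y)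
    (N : ℕ) {C : ℝ} (hC : ∀ n, N ≤ n → P n C) {n₀ : ℕ} (h : ∀ n, n₀ ≤ n → ∃ x, P n x) :
    ∃ C, 0 < C ∧ ∀ n, n₀ ≤ n → P n C := by
  choose! x hx using h
  refine ⟨|C| + ∑ n ∈ Finset.range N, |x n| + 1, by positivity, fun n hn => ?_⟩
  have hs : 0 ≤ ∑ n ∈ Finset.range N, |x n| := by positivity
  rcases Nat.lt_or_ge n N with h | h
  · refine hP n _ _ ?_ (hx n hn)
    have := Finset.single_le_sum (f := fun n => |x n|) (fun _ _ => abs_nonneg _)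
      (Finset.mem_range.2 h)
    have := le_abs_self (x n)
    have := abs_nonneg C
    linarith
  · refine hP n _ _ ?_ (hC n h)
    have := le_abs_self C
    linarith

theorem rpow_neg_half (n : ℕ) : (n : ℝ) ^ (-(1 / 2) : ℝ) = (√(n : ℝ))⁻¹ := by
  rw [Real.rpow_neg (by positivity), Real.sqrt_eq_rpow]

/-- A triangulation exists and has degree at least `n - 3 ≥ 1`, so there are two vertices. -/
theorem exists_cut {n : ℕ} (hn : 4 ≤ n) : ∃ S : Finset (OPT n), S.Nonempty ∧ Sᶜ.Nonempty := by
  have h2 : 1 < Fintype.card (OPT n) := by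
    obtain ⟨m, rfl⟩ : ∃ m, n = m + 4 := ⟨n - 4, by omega⟩
    have : Nonempty (OPT (m + 4)) := by
      rw [← Fintype.card_pos_iff, card_OPT (by omega)]; exact cat_pos (m + 3)
    obtain ⟨T⟩ := this
    have hdeg := le_degree (by omega) T
    exact lt_of_le_of_lt (by omega) ((flipGraph (m + 4)).degree_lt_card_verts T)
  obtain ⟨T, T', hne⟩ := Fintype.exists_pair_of_one_lt_card h2
  exact ⟨{T}, Finset.singleton_nonempty T, T', by simpa using hne.symm⟩

/-- The thick cut serves for large `n`; for the finitely many remaining `n` any cut does, at the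
price of the constant. -/
theorem exists_const_cutRatio : ∃ C : ℝ, 0 < C ∧ ∀ n : ℕ, 4 ≤ n →
    ∃ S : Finset (OPT n), S.Nonempty ∧ Sᶜ.Nonempty ∧
      cutRatio (flipGraph n) S ≤ C * (√(n : ℝ))⁻¹ := by
  refine exists_const_of_eventually (P := fun n C => ∃ S : Finset (OPT n), S.Nonempty ∧
    Sᶜ.Nonempty ∧ cutRatio (flipGraph n) S ≤ C * (√(n : ℝ))⁻¹) ?_ 10000
    (fun n hn => ⟨thick n, cutRatio_thick_le hn⟩) ?_
  · rintro n x y hxy ⟨S, h, h', hle⟩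
    exact ⟨S, h, h', hle.trans (by gcongr)⟩
  · intro n hn
    obtain ⟨S, h, h'⟩ := exists_cut hn
    have : 0 < √(n : ℝ) := Real.sqrt_pos.2 (by exact_mod_cast (by omega : 0 < n))
    exact ⟨cutRatio (flipGraph n) S * √(n : ℝ), S, h, h', by rw [mul_inv_cancel_right₀ this.ne']⟩

theorem exists_const_volRatio : ∃ C : ℝ, 0 < C ∧ ∀ n : ℕ, 4 ≤ n →
    ∃ S : Finset (OPT n), S.Nonempty ∧ Sᶜ.Nonempty ∧
      volRatio (flipGraph n) S ≤ C * (n : ℝ) ^ (-(3 / 2) : ℝ) := by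
  obtain ⟨C, hC, h⟩ := exists_const_cutRatio
  refine ⟨4 * C, by positivity, fun n hn => ?_⟩
  obtain ⟨S, hS, hS', hle⟩ := h n hn
  refine ⟨S, hS, hS', ?_⟩
  have hn' : (0 : ℝ) < n := by exact_mod_cast (by omega : 0 < n)
  -- `n ≥ 4` gives `n - 3 ≥ n / 4`, the source of the factor 4.
  have hd : (n : ℝ) / 4 ≤ ((n - 3 : ℕ) : ℝ) := by
    rw [div_le_iff₀ (by norm_num)]; exact_mod_cast (by omega : n ≤ (n - 3) * 4)
  calc volRatio (flipGraph n) S ≤ cutRatio (flipGraph n) S / ((n - 3 : ℕ) : ℝ) :=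
        volRatio_le_cutRatio_div _ (le_degree (by omega)) (by omega) hS hS'
    _ ≤ (C * (√(n : ℝ))⁻¹) / ((n : ℝ) / 4) := by gcongr
    _ = 4 * C * ((n : ℝ) ^ (-1 : ℝ) * (n : ℝ) ^ (-(1 / 2) : ℝ)) := by
        rw [rpow_neg_half, Real.rpow_neg_one]; field_simp
    _ = _ := by rw [← Real.rpow_add hn']; norm_num

end OuterPlanar

theorem mainTheorem5 :
    -- the number of vertices of the flip graph is a Catalan number
    (∀ n : ℕ, 3 ≤ n → Fintype.card (OuterPlanar.OPT n) = catalan (n - 2)) ∧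
    -- isoperimetric constant
    (∃ C : ℝ, 0 < C ∧ ∀ n : ℕ, 4 ≤ n →
      OuterPlanar.isoperimetricConstant (OuterPlanar.flipGraph n) ≤ C * (n : ℝ) ^ (-(1 / 2) : ℝ)) ∧
    -- for odd `n` the cut into thick and thin triangulations achieves this bound
    (∃ C : ℝ, 0 < C ∧ ∀ n : ℕ, 11 ≤ n → Odd n →
      (OuterPlanar.thick n).Nonempty ∧ (OuterPlanar.thick n)ᶜ.Nonempty ∧
      OuterPlanar.cutRatio (OuterPlanar.flipGraph n) (OuterPlanar.thick n) ≤
        C * (n : ℝ) ^ (-(1 / 2) : ℝ)) ∧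
    -- valence-normalized Cheeger constant
    (∃ C : ℝ, 0 < C ∧ ∀ n : ℕ, 4 ≤ n →
      OuterPlanar.cheegerConstant (OuterPlanar.flipGraph n) ≤ C * (n : ℝ) ^ (-(3 / 2) : ℝ)) ∧
    -- spectral gap of the normalized Laplacian
    (∃ C : ℝ, 0 < C ∧ ∀ n : ℕ, 4 ≤ n →
      OuterPlanar.spectralGap (OuterPlanar.flipGraph n) ≤ C * (n : ℝ) ^ (-(3 / 2) : ℝ)) ∧
    -- mixing time of the simple random walk
    (∀ ε : ℝ, 0 < ε → ε < 1 / 2 → ∃ c : ℝ, 0 < c ∧ ∀ n : ℕ, 4 ≤ n →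
      ENNReal.ofReal (c * (n : ℝ) ^ (3 / 2 : ℝ)) ≤
        ((OuterPlanar.mixingTime (OuterPlanar.flipGraph n) ε : ℕ∞) : ℝ≥0∞)) := by
  open OuterPlanar in
  obtain ⟨C₁, hC₁, h₁⟩ := exists_const_cutRatio
  obtain ⟨C₂, hC₂, h₂⟩ := exists_const_volRatio
  have hdeg : ∀ {n : ℕ}, 4 ≤ n → ∀ T : OPT n, 0 < (flipGraph n).degree T := fun hn T =>
    lt_of_lt_of_le (by omega) (le_degree (by omega) T)
  refine ⟨fun n => card_OPT, ⟨C₁, hC₁, fun n hn => ?_⟩, ?_, ⟨C₂, hC₂, fun n hn => ?_⟩,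
    ⟨2 * C₂, by positivity, fun n hn => ?_⟩, fun ε _ hε => ⟨(1 / 2 - ε) / C₂, ?_, fun n hn => ?_⟩⟩
  · obtain ⟨S, hS, hS', hle⟩ := h₁ n hn
    rw [rpow_neg_half]
    exact (isoperimetricConstant_le _ hS hS').trans hle
  -- Here the cut is prescribed, so for small `n` its own ratio goes into the constant.
  · obtain ⟨C, hC, h⟩ := exists_const_of_eventually
      (P := fun n C => cutRatio (flipGraph n) (thick n) ≤ C * (√(n : ℝ))⁻¹) (n₀ := 11)
      (fun n x y hxy h => h.trans (by gcongr)) 10000 (fun n hn => (cutRatio_thick_le hn).2.2)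
      (fun n hn => by
        have : 0 < √(n : ℝ) := Real.sqrt_pos.2 (by exact_mod_cast (by omega : 0 < n))
        exact ⟨cutRatio (flipGraph n) (thick n) * √(n : ℝ),
          by rw [mul_inv_cancel_right₀ this.ne']⟩)
    refine ⟨C, hC, fun n hn hodd => ⟨thick_nonempty hn, thin_nonempty hn hodd, ?_⟩⟩
    rw [rpow_neg_half]
    exact h n hn
  · obtain ⟨S, hS, hS', hle⟩ := h₂ n hn
    exact (cheegerConstant_le _ hS hS').trans hle
  · obtain ⟨S, hS, hS', hle⟩ := h₂ n hn
    refine (spectralGap_le _ (hdeg hn) hS hS').trans ?_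
    rw [mul_assoc]
    gcongr
  · exact div_pos (by linarith) hC₂
  · obtain ⟨S, hS, hS', hle⟩ := h₂ n hn
    have hn' : (0 : ℝ) < n := by exact_mod_cast (by omega : 0 < n)
    refine le_mixingTime _ fun t ht => ?_
    have h := (le_mul_volRatio _ (hdeg hn) hS hS' ht).trans
      (mul_le_mul_of_nonneg_left hle (Nat.cast_nonneg t))
    rw [Real.rpow_neg hn'.le] at h
    have hpow : 0 < (n : ℝ) ^ (3 / 2 : ℝ) := Real.rpow_pos_of_pos hn' _
    rw [div_mul_eq_mul_div, div_le_iff₀ hC₂, ← le_div_iff₀ hpow, mul_div_assoc, div_eq_mul_inv]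
    rwa [div_eq_mul_inv] at h
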